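/- **Proposition.** Let $\pi\colon E\to M$ be a smooth real vector bundle of finite rank over a smooth (Hausdorff, second countable, finite-dimensional) manifold $M$. Write $E_p=\pi^{-1}(p)$ and $\mathrm{Ver}(TE)=\ker T\pi\subseteq TE$; a multivector field on $E$ is called vertical if it is a section of $\Lambda^\bullet\mathrm{Ver}(TE)$. For $e\in E_p$ the vertical lift at $e$ of $v\in E_p$ is $v^{\mathrm{ver}}(e)=\frac{d}{dt}\big|_{t=0}(e+tv)\in T_eE$; it is linear in $v$, and the vertical lift $\gamma^{\mathrm{ver}}$ of a section $\gamma$ of $\Lambda^2E$ is the bivector field on $E$ obtained by applying $\Lambda^2$ of this linear map to $\gamma(\pi(e))$ for each $e\in E$. There is a $d_0\in\mathbb N$, depending only on $E$, such that for every $d\ge d_0$, every smooth section $\gamma\in\Gamma^\infty(\Lambda^2E)$ and every open neighbourhood $\mathcal U\subseteq E$ of the zero section, there exist $2d$ smooth vector fields $X_1,\dots,X_d,Y_1,\dots,Y_d$ on $E$ and an open neighbourhood $\tilde{\mathcal U}\subseteq\mathcal U$ of the zero section such that: 1. $X_i,Y_i$ are vertical for all $i$; 2. $\operatorname{supp}X_i,\operatorname{supp}Y_i\subseteq\mathcal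 U$, and $\operatorname{supp}X_i\cap E_p$ and $\operatorname{supp}Y_i\cap E_p$ are compact for all $i$ and all $p\in M$; 3. $[X_i,X_j]=[X_i,Y_j]=[Y_i,Y_j]=0$ for all $i,j$; 4. each $X_i$ and each $Y_i$ is complete, i.e. through every point of $E$ passes an integral curve defined on all of $\mathbb R$; 5. $\theta=\sum_{i=1}^dX_i\wedge Y_i$ is a vertical Poisson structure (a smooth vertical bivector field on $E$ whose bracket $\{f,g\}=\theta(df,dg)$ on $C^\infty(E)$ satisfies the Jacobi identity), and $\theta=\gamma^{\mathrm{ver}}$ on $\tilde{\mathcal U}$. -/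

import Mathlib

open Set Bundle
open scoped Manifold ContDiff

noncomputable section

namespace VerticalPoisson

section Bivectors

variable {EB : Type*} [NormedAddCommGroup EB] [NormedSpace ℝ EB]
  {HB : Type*} [TopologicalSpace HB] (IB : ModelWithCorners ℝ EB HB)
  {B : Type*} [TopologicalSpace B] [ChartedSpace HB B]

/-- The wedge product `v ∧ w` of two vectors, as an element of the second exterior power. -/
def wedge {V : Type*} [AddCommGroup V] [Module ℝ V] (v w : V) : ⋀[ℝ]^2 V :=
  exteriorPower.ιMulti ℝ 2 ![v, w]

/-- A section `σ` of the bundle `Λ² V` over `B` is smooth if its representative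
`B ⊇ U → Λ² F` in every distinguished local trivialization `V|_U ≃ U × F` is smooth, that is,
if all coordinates (linear functionals) of this representative are smooth on `U`. -/
def IsSmoothBivectorSection (F : Type*) [NormedAddCommGroup F] [NormedSpace ℝ F]
    (V : B → Type*) [TopologicalSpace (TotalSpace F V)]
    [∀ x, AddCommGroup (V x)] [∀ x, Module ℝ (V x)] [∀ x, TopologicalSpace (V x)]
    [FiberBundle F V] [VectorBundle ℝ F V] (σ : ∀ x, ⋀[ℝ]^2 (V x)) : Prop :=
  ∀ (x₀ : B) (ℓ : Module.Dual ℝ (⋀[ℝ]^2 F)),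
    ContMDiffOn IB 𝓘(ℝ, ℝ) ∞
      (fun x => ℓ (exteriorPower.map 2 ((trivializationAt F V x₀).linearMapAt ℝ x) (σ x)))
      (trivializationAt F V x₀).baseSet

/-- The bracket `{f, g} = θ(df, dg)` of two functions defined by a bivector field `θ`. For
`θ = X ∧ Y` it is `df(X) dg(Y) - df(Y) dg(X)`. -/
def poissonBracket (θ : ∀ x : B, ⋀[ℝ]^2 (TangentSpace IB x)) (f g : B → ℝ) (x : B) : ℝ :=
  let df : Module.Dual ℝ (TangentSpace IB x) := (mfderiv IB 𝓘(ℝ, ℝ) f x).toLinearMap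
  let dg : Module.Dual ℝ (TangentSpace IB x) := (mfderiv IB 𝓘(ℝ, ℝ) g x).toLinearMap
  exteriorPower.pairingDual ℝ (TangentSpace IB x) 2 (wedge df dg) (θ x)

/-- A Poisson structure: a smooth bivector field whose bracket on smooth functions satisfies the
Jacobi identity. -/
structure IsPoissonStructure [IsManifold IB ∞ B]
    (θ : ∀ x : B, ⋀[ℝ]^2 (TangentSpace IB x)) : Prop where
  smooth : IsSmoothBivectorSection IB EB (TangentSpace IB : B → Type _) θ
  jacobi : ∀ f g h : B → ℝ, ContMDiff IB 𝓘(ℝ, ℝ) ∞ f → ContMDiff IB 𝓘(ℝ, ℝ) ∞ g →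
    ContMDiff IB 𝓘(ℝ, ℝ) ∞ h → ∀ x,
      poissonBracket IB θ f (poissonBracket IB θ g h) x
        + poissonBracket IB θ g (poissonBracket IB θ h f) x
        + poissonBracket IB θ h (poissonBracket IB θ f g) x = 0

end Bivectors

section VectorFields

variable {EN : Type*} [NormedAddCommGroup EN] [NormedSpace ℝ EN]
  {HN : Type*} [TopologicalSpace HN] (IN : ModelWithCorners ℝ EN HN)
  {N : Type*} [TopologicalSpace N] [ChartedSpace HN N]

/-- A smooth vector field on `N`. -/
def IsSmoothVectorField [IsManifold IN ∞ N] (X : ∀ e : N, TangentSpace IN e) : Prop :=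
  ContMDiff IN IN.tangent ∞ (fun e => (⟨e, X e⟩ : TangentBundle IN N))

/-- The support of a vector field: the closure of the set where it does not vanish. -/
def vsupp (X : ∀ e : N, TangentSpace IN e) : Set N :=
  closure {e | X e ≠ 0}

/-- The vector field `X` is complete: through every point passes an integral curve of `X` that is
defined on all of `ℝ`. -/
def IsCompleteVectorField (X : ∀ e : N, TangentSpace IN e) : Prop :=
  ∀ e : N, ∃ c : ℝ → N, c 0 = e ∧ IsMIntegralCurve (I := IN) c X

/-- The Lie bracket of the vector fields `X` and `Y` vanishes. -/
def Commute (X Y : ∀ e : N, TangentSpace IN e) : Prop :=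
  ∀ e : N, VectorField.mlieBracket IN X Y e = 0

end VectorFields

section Vertical

variable {EB : Type*} [NormedAddCommGroup EB] [NormedSpace ℝ EB]
  {HB : Type*} [TopologicalSpace HB] (IB : ModelWithCorners ℝ EB HB)
  {B : Type*} [TopologicalSpace B] [ChartedSpace HB B]
  {F : Type*} [NormedAddCommGroup F] [NormedSpace ℝ F]
  {E : B → Type*} [TopologicalSpace (TotalSpace F E)]
  [∀ x, AddCommGroup (E x)] [∀ x, Module ℝ (E x)] [∀ x, TopologicalSpace (E x)]
  [FiberBundle F E]

/-- The vertical tangent space `Ver_e = ker T_e π`. -/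
def vertSpace (e : TotalSpace F E) : Submodule ℝ (TangentSpace (IB.prod 𝓘(ℝ, F)) e) :=
  LinearMap.ker
    (mfderiv (IB.prod 𝓘(ℝ, F)) IB (TotalSpace.proj : TotalSpace F E → B) e).toLinearMap

/-- The bivector `w` at `e` lies in `Λ² Ver_e ⊆ Λ² T_e E`. -/
def IsVerticalBivector (e : TotalSpace F E)
    (w : ⋀[ℝ]^2 (TangentSpace (IB.prod 𝓘(ℝ, F)) e)) : Prop :=
  w ∈ LinearMap.range (exteriorPower.map 2 (vertSpace IB e).subtype)

/-- The vertical lift of the vector `v ∈ E_p` to `e ∈ E_p`: the velocity at `t = 0` of the curve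
`t ↦ e + t v`. -/
def vertLiftVec (e : TotalSpace F E) (v : E e.proj) : TangentSpace (IB.prod 𝓘(ℝ, F)) e :=
  mfderiv 𝓘(ℝ, ℝ) (IB.prod 𝓘(ℝ, F))
    (fun t : ℝ => (⟨e.proj, e.snd + t • v⟩ : TotalSpace F E)) 0 (1 : ℝ)

variable [VectorBundle ℝ F E]

/-- In the preferred chart at `e`, the vertical lift of `v` is `(0, L v)`, where `L` is the local
trivialization. -/
theorem vertLiftVec_eq (e : TotalSpace F E) (v : E e.proj) :
    vertLiftVec IB e v =
      ((0, (trivializationAt F E e.proj).linearMapAt ℝ e.proj v) : EB × F) := by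
  let T := trivializationAt F E e.proj
  let L := T.linearMapAt ℝ e.proj
  have hb : e.proj ∈ T.baseSet := FiberBundle.mem_baseSet_trivializationAt F E e.proj
  let c : ℝ → TotalSpace F E := fun t => ⟨e.proj, e.snd + t • v⟩
  have hT : ∀ t : ℝ, T (c t) = (e.proj, L e.snd + t • L v) := fun t => by
    have h1 : L (e.snd + t • v) = (T ⟨e.proj, e.snd + t • v⟩).2 := by
      simp only [L, Trivialization.coe_linearMapAt, if_pos hb]
    refine Prod.ext (T.coe_fst' hb) ?_
    rw [← map_smul, ← map_add, h1]
  have hc : MDifferentiableAt 𝓘(ℝ, ℝ) (IB.prod 𝓘(ℝ, F)) c 0 := by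
    rw [mdifferentiableAt_totalSpace]
    refine ⟨mdifferentiableAt_const, ?_⟩
    change MDifferentiableAt 𝓘(ℝ, ℝ) 𝓘(ℝ, F) (fun t => (T (c t)).2) 0
    simp only [hT]
    exact (by fun_prop : DifferentiableAt ℝ (fun t : ℝ => L e.snd + t • L v) 0).mdifferentiableAt
  have hw : writtenInExtChartAt 𝓘(ℝ, ℝ) (IB.prod 𝓘(ℝ, F)) 0 c =
      fun t : ℝ => (extChartAt IB e.proj e.proj, L e.snd + t • L v) := by
    funext t
    have h2 : extChartAt (IB.prod 𝓘(ℝ, F)) (c 0) (c t) =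
        ((extChartAt IB e.proj).prod (PartialEquiv.refl F)) (T (c t)) := by
      rw [FiberBundle.extChartAt]; rfl
    have h3 : writtenInExtChartAt 𝓘(ℝ, ℝ) (IB.prod 𝓘(ℝ, F)) 0 c t =
      extChartAt (IB.prod 𝓘(ℝ, F)) (c 0) (c t) := rfl
    rw [h3, h2, hT]; rfl
  have hd : HasFDerivAt (fun t : ℝ => (extChartAt IB e.proj e.proj, L e.snd + t • L v))
      ((0 : ℝ →L[ℝ] EB).prod ((1 : ℝ →L[ℝ] ℝ).smulRight (L v))) 0 := by
    refine HasFDerivAt.prodMk (hasFDerivAt_const _ _) ?_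
    exact ((hasFDerivAt_id (𝕜 := ℝ) (0 : ℝ)).smul_const (L v)).const_add _
  have hm : mfderiv 𝓘(ℝ, ℝ) (IB.prod 𝓘(ℝ, F)) c 0 =
      ((0 : ℝ →L[ℝ] EB).prod ((1 : ℝ →L[ℝ] ℝ).smulRight (L v))) := by
    rw [hc.mfderiv, hw]
    have h0 : extChartAt 𝓘(ℝ, ℝ) (0 : ℝ) 0 = 0 := rfl
    rw [h0, ModelWithCorners.range_eq_univ, fderivWithin_univ]
    exact hd.fderiv
  change mfderiv 𝓘(ℝ, ℝ) (IB.prod 𝓘(ℝ, F)) c 0 (1 : ℝ) = _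
  rw [hm]
  change ((0 : EB), (1 : ℝ) • L v) = _
  rw [one_smul]

/-- The vertical lift to `e ∈ E_p` as a linear map `E_p → T_e E`. -/
def vertLift (e : TotalSpace F E) :
    E e.proj →ₗ[ℝ] TangentSpace (IB.prod 𝓘(ℝ, F)) e where
  toFun := vertLiftVec IB e
  map_add' v w := by
    rw [vertLiftVec_eq, vertLiftVec_eq, vertLiftVec_eq, map_add]
    exact (Prod.ext (add_zero _).symm rfl)
  map_smul' r v := by
    rw [vertLiftVec_eq, vertLiftVec_eq, map_smul]
    exact (Prod.ext (smul_zero r).symm rfl)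

/-- The vertical lift `γ^ver` of a section `γ` of `Λ² E`, a bivector field on the total space. -/
def vertLiftBivector (γ : ∀ p, ⋀[ℝ]^2 (E p)) (e : TotalSpace F E) :
    ⋀[ℝ]^2 (TangentSpace (IB.prod 𝓘(ℝ, F)) e) :=
  exteriorPower.map 2 (vertLift IB e) (γ e.proj)

end Vertical

end VerticalPoisson

end

/-! Vertical lifts of sections of `E` are constant along each fibre, so they commute, and a
decomposition γ = ∑ Sᵢ ∧ Tᵢ into sections of `E` lifts to a sum of wedges of commuting fields equal
to γ^ver. The difficulty is to cut these lifts off inside the given neighbourhood without losing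
commutativity, which multiplication by a bump function would destroy.

The cutoff is nonlinear and radial. With a fibre metric and q = |y|², the constant field v is
replaced by α(q) v + β(q) ⟨y, v⟩ y, the shape taken by the push-forward of v under a radial map x ↦
φ(|x|²) x. Any two such fields commute once 2α'(α + βq) = αβ (`fderiv_cutoffField_comm`), and
`exists_cutoff` solves this equation with α = 1, β = 0 for q ≤ 1/4 and α = β = 0 for q ≥ 1. The
resulting fields agree with the lifts near the zero section and have compact support on each fibre,
hence are complete. Being vertical, they have brackets that can be computed fibre by fibre
(`mlieBracket_vertLift_eq_zero`), and commuting fields make ∑ Xᵢ ∧ Yᵢ Poisson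
(`fieldBracket_jacobi`).

Three global constructions feed this. General position gives d generating sections Sᵢ for every d >
dim M + rank E (`exists_generating_sections`), which is why the bound depends on `E` only. A smooth
right inverse and a partition of unity give the Tᵢ (`exists_wedge_decomposition`). Averaging
rescaled local metrics gives a fibre metric whose unit balls lie in the neighbourhood
(`exists_fiber_metric`). -/

namespace VerticalPoisson

/-! ### Algebra of the second exterior power. -/

section ExteriorSquare

variable {V W : Type*} [AddCommGroup V] [Module ℝ V] [AddCommGroup W] [Module ℝ W]

theorem map_wedge (f : V →ₗ[ℝ] W) (v w : V) :
    exteriorPower.map 2 f (wedge v w) = wedge (f v) (f w) := by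
  rw [wedge, exteriorPower.map_apply_ιMulti, wedge]
  congr 1
  ext i
  fin_cases i <;> rfl

theorem wedge_add_left (v v' w : V) : wedge (v + v') w = wedge v w + wedge v' w := by
  have e : ∀ x, Function.update ![v, w] 0 x = ![x, w] := fun x => by
    ext i; fin_cases i <;> rfl
  simpa only [e, wedge] using (exteriorPower.ιMulti ℝ 2 (M := V)).map_update_add ![v, w] 0 v v'

theorem wedge_add_right (v w w' : V) : wedge v (w + w') = wedge v w + wedge v w' := by
  have e : ∀ x, Function.update ![v, w] 1 x = ![v, x] := fun x => by
    ext i; fin_cases i <;> rfl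
  simpa only [e, wedge] using (exteriorPower.ιMulti ℝ 2 (M := V)).map_update_add ![v, w] 1 w w'

theorem wedge_smul_left (c : ℝ) (v w : V) : wedge (c • v) w = c • wedge v w := by
  have e : ∀ x, Function.update ![v, w] 0 x = ![x, w] := fun x => by
    ext i; fin_cases i <;> rfl
  simpa only [e, wedge] using (exteriorPower.ιMulti ℝ 2 (M := V)).map_update_smul ![v, w] 0 c v

theorem wedge_smul_right (c : ℝ) (v w : V) : wedge v (c • w) = c • wedge v w := by
  have e : ∀ x, Function.update ![v, w] 1 x = ![v, x] := fun x => by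
    ext i; fin_cases i <;> rfl
  simpa only [e, wedge] using (exteriorPower.ιMulti ℝ 2 (M := V)).map_update_smul ![v, w] 1 c w

variable (V) in
/-- The wedge product of two vectors as a bilinear map. -/
noncomputable def wedgeₗ : V →ₗ[ℝ] V →ₗ[ℝ] ⋀[ℝ]^2 V :=
  LinearMap.mk₂ ℝ wedge wedge_add_left wedge_smul_left wedge_add_right wedge_smul_right

@[simp]
theorem wedgeₗ_apply (v w : V) : wedgeₗ V v w = wedge v w := rfl

theorem pairingDual_wedge_wedge (f g : Module.Dual ℝ V) (v w : V) :
    exteriorPower.pairingDual ℝ V 2 (wedge f g) (wedge v w) = f v * g w - f w * g v := by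
  rw [wedge, wedge, exteriorPower.pairingDual_ιMulti_ιMulti, Matrix.det_fin_two]
  simp
  ring

theorem span_wedge : Submodule.span ℝ (range fun x : V × V => wedge x.1 x.2) = ⊤ := by
  rw [eq_top_iff, ← exteriorPower.ιMulti_span ℝ 2 V]
  refine Submodule.span_mono ?_
  rintro _ ⟨a, rfl⟩
  refine ⟨(a 0, a 1), ?_⟩
  change exteriorPower.ιMulti ℝ 2 ![a 0, a 1] = _
  congr 1
  ext i
  fin_cases i <;> rfl

/-- Every bivector is a sum of wedge products with the members of a basis, with second factors
depending linearly on it. -/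
theorem exists_linear_wedge_decomposition {ι : Type*} [Fintype ι] (b : Module.Basis ι ℝ V) :
    ∃ G : ι → ⋀[ℝ]^2 V →ₗ[ℝ] V, ∀ w, ∑ i, wedge (b i) (G i w) = w := by
  let Ψ : (ι → V) →ₗ[ℝ] ⋀[ℝ]^2 V := ∑ i, (wedgeₗ V (b i)) ∘ₗ LinearMap.proj i
  have hΨ : ∀ v, Ψ v = ∑ i, wedge (b i) (v i) := fun v => by simp [Ψ]
  have hs : LinearMap.range Ψ = ⊤ := by
    rw [eq_top_iff, ← span_wedge, Submodule.span_le]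
    rintro _ ⟨⟨v, w⟩, rfl⟩
    refine ⟨fun i => b.repr v i • w, ?_⟩
    rw [hΨ]
    simp only [wedge_smul_right, ← wedge_smul_left]
    conv_rhs => rw [← b.sum_repr v]
    simp only [← wedgeₗ_apply, map_sum, LinearMap.sum_apply]
  -- A linear section of the surjection (vᵢ) ↦ ∑ bᵢ ∧ vᵢ; its components are the required maps.
  obtain ⟨g, hg⟩ := Ψ.exists_rightInverse_of_surjective hs
  refine ⟨fun i => LinearMap.proj i ∘ₗ g, fun w => ?_⟩
  rw [← hΨ]
  exact LinearMap.congr_fun hg w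

theorem sum_wedge_mem_range {ι : Type*} [Fintype ι] (S : Submodule ℝ V) {v w : ι → V}
    (hv : ∀ i, v i ∈ S) (hw : ∀ i, w i ∈ S) :
    ∑ i, wedge (v i) (w i) ∈ LinearMap.range (exteriorPower.map 2 S.subtype) :=
  Submodule.sum_mem _ fun i _ => ⟨wedge ⟨v i, hv i⟩ ⟨w i, hw i⟩, map_wedge _ _ _⟩

end ExteriorSquare

/-! ### Maps into a space of larger dimension are not surjective. -/

section Dimension

variable {V W : Type*} [NormedAddCommGroup V] [NormedSpace ℝ V] [FiniteDimensional ℝ V]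
  [NormedAddCommGroup W] [NormedSpace ℝ W] [FiniteDimensional ℝ W]

/-- The easy case of Sard's theorem: a C¹ map is locally Lipschitz, so it does not raise Hausdorff
dimension, and the complement of its image is dense. -/
theorem exists_notMem_image_of_contDiffOn {f : V → W} {s : Set V} (hs : IsOpen s)
    (hf : ContDiffOn ℝ 1 f s) (h : Module.finrank ℝ V < Module.finrank ℝ W) :
    ∃ w, w ∉ f '' s := by
  have h1 : dimH (f '' s) ≤ dimH s := by
    have : SecondCountableTopology V := secondCountable_of_proper
    refine dimH_image_le_of_locally_lipschitzOn fun x hx => ?_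
    obtain ⟨K, t, ht, hK⟩ := (hf.contDiffAt (hs.mem_nhds hx)).exists_lipschitzOnWith
    exact ⟨K, t, mem_nhdsWithin_of_mem_nhds ht, hK⟩
  have h2 : dimH s ≤ Module.finrank ℝ V :=
    (dimH_mono (subset_univ s)).trans (Real.dimH_univ_eq_finrank V).le
  exact (dense_compl_of_dimH_lt_finrank
    ((h1.trans h2).trans_lt (Nat.cast_lt.2 h))).nonempty

end Dimension

/-! ### The radial cutoff functions. -/

section Cutoff

/-- The relation x² g' = g is the division-free form of g' = g/x² and also holds for x ≤ 0. It is
what later allows a factor α to be cancelled where α vanishes. -/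
theorem expNegInvGlue_hasDerivAt (x : ℝ) :
    ∃ y, HasDerivAt expNegInvGlue y x ∧ x ^ 2 * y = expNegInvGlue x ∧ 0 ≤ y ∧ (x ≤ 0 → y = 0) := by
  refine ⟨deriv expNegInvGlue x, ?_, ?_, ?_, ?_⟩
  · exact ((expNegInvGlue.contDiff (n := 1)).differentiable one_ne_zero x).hasDerivAt
  · rcases lt_trichotomy x 0 with h | h | h
    · have : expNegInvGlue =ᶠ[nhds x] fun _ => 0 := by
        filter_upwards [Iio_mem_nhds h] with y hy using expNegInvGlue.zero_of_nonpos (le_of_lt hy)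
      rw [this.deriv_eq, expNegInvGlue.zero_of_nonpos h.le]; simp
    · subst h; simp [expNegInvGlue.zero]
    · have : expNegInvGlue =ᶠ[nhds x] fun y => Real.exp (-y⁻¹) := by
        filter_upwards [Ioi_mem_nhds h] with y hy
        rw [expNegInvGlue, if_neg (not_le.2 hy)]
      rw [this.deriv_eq, this.eq_of_nhds]
      have hd : HasDerivAt (fun y : ℝ => Real.exp (-y⁻¹)) (Real.exp (-x⁻¹) * -(-(x ^ 2)⁻¹)) x :=
        ((hasDerivAt_inv h.ne').neg).exp
      rw [hd.deriv]
      field_simp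
  · exact expNegInvGlue.monotone.deriv_nonneg
  · intro h
    have hmin : IsLocalMin expNegInvGlue x := by
      refine Filter.Eventually.of_forall fun y => ?_
      rw [expNegInvGlue.zero_of_nonpos h]; exact expNegInvGlue.nonneg y
    exact hmin.deriv_eq_zero

/-- Cutoff functions `α`, `β` for which the vector fields `y ↦ α(|y|²) v + β(|y|²) ⟨y, v⟩ y`
commute. -/
theorem exists_cutoff : ∃ α β : ℝ → ℝ, ContDiff ℝ ∞ α ∧ ContDiff ℝ ∞ β ∧
    (∀ q ≤ 1 / 4, α q = 1 ∧ β q = 0) ∧ (∀ q, 1 ≤ q → α q = 0 ∧ β q = 0) ∧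
    ∀ q, 2 * deriv α q * (α q + β q * q) = α q * β q := by
  -- Normalised so that τ, which is 1 up to q = 1/4, reaches 0 exactly at q = 1; likewise `c` below
  -- makes α = 1 where τ = 1.
  let C : ℝ := (expNegInvGlue (3 / 4))⁻¹
  have hg0 : 0 < expNegInvGlue (3 / 4) := expNegInvGlue.pos_of_pos (by norm_num)
  have hC : 0 < C := inv_pos.2 hg0
  let τ : ℝ → ℝ := fun q => 1 - C * expNegInvGlue (q - 1 / 4)
  have hτ : ContDiff ℝ ∞ τ :=
    contDiff_const.sub (contDiff_const.mul (expNegInvGlue.contDiff.comp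
      (contDiff_id.sub contDiff_const)))
  have hτ' : ContDiff ℝ ∞ (deriv τ) := (contDiff_infty_iff_deriv.1 hτ).2
  let c : ℝ := (expNegInvGlue 1)⁻¹
  have hc1 : 0 < expNegInvGlue 1 := expNegInvGlue.pos_of_pos one_pos
  let α : ℝ → ℝ := fun q => c * expNegInvGlue (τ q)
  have hα : ContDiff ℝ ∞ α := contDiff_const.mul (expNegInvGlue.contDiff.comp hτ)
  -- The equation gives β = 2αα' / (α - 2qα'), which is 0/0 where α vanishes. Multiplying numerator
  -- and denominator by τ² and using τ²α' = τ'α cancels one α and leaves β = 2ατ' / D. Here D = 1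
  -- for q ≤ 1/4, and D > 0 beyond because there τ' < 0.
  let D : ℝ → ℝ := fun q => τ q ^ 2 - 2 * q * deriv τ q
  have hD : ContDiff ℝ ∞ D :=
    (hτ.pow 2).sub ((contDiff_const.mul contDiff_id).mul hτ')
  have dτ : ∀ q, ∃ y, HasDerivAt τ (-(C * y)) q ∧ 0 ≤ y ∧
      (q - 1 / 4) ^ 2 * y = expNegInvGlue (q - 1 / 4) ∧ (q ≤ 1 / 4 → y = 0) := fun q => by
    obtain ⟨y, h1, h2, h3, h4⟩ := expNegInvGlue_hasDerivAt (q - 1 / 4)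
    refine ⟨y, ?_, h3, h2, fun h => h4 (by linarith)⟩
    have := (HasDerivAt.comp q h1 ((hasDerivAt_id q).sub_const (1 / 4))).const_mul C
    simpa [τ] using! this.const_sub 1
  have τ1 : ∀ q ≤ 1 / 4, τ q = 1 ∧ deriv τ q = 0 := fun q hq => by
    obtain ⟨y, h1, -, -, h4⟩ := dτ q
    refine ⟨?_, ?_⟩
    · simp only [τ]; rw [expNegInvGlue.zero_of_nonpos (by linarith)]; simp
    · rw [h1.deriv, h4 hq]; simp
  have hDpos : ∀ q, 0 < D q := fun q => by
    rcases le_or_gt q (1 / 4) with hq | hq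
    · simp only [D]; rw [(τ1 q hq).1, (τ1 q hq).2]; norm_num
    · obtain ⟨y, h1, h2, h3, -⟩ := dτ q
      have hy : 0 < y := by
        refine lt_of_le_of_ne h2 fun h => ?_
        have := expNegInvGlue.pos_of_pos (sub_pos.2 hq)
        rw [← h3, ← h] at this
        simp at this
      simp only [D]; rw [h1.deriv]
      have : 0 < q * (C * y) := by positivity
      nlinarith [sq_nonneg (τ q)]
  have hα' : ∀ q, τ q ^ 2 * deriv α q = deriv τ q * α q := fun q => by
    obtain ⟨y, h1, h2, -, -⟩ := expNegInvGlue_hasDerivAt (τ q)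
    have h3 : HasDerivAt τ (deriv τ q) q := (hτ.differentiable (by simp) q).hasDerivAt
    have h4 : HasDerivAt α (c * (y * deriv τ q)) q := (HasDerivAt.comp q h1 h3).const_mul c
    rw [h4.deriv]
    simp only [α]; rw [← h2]; ring
  refine ⟨α, fun q => 2 * α q * deriv τ q / D q, hα, ?_, ?_, ?_, ?_⟩
  · exact ((contDiff_const.mul hα).mul hτ').div hD fun q => (hDpos q).ne'
  · intro q hq
    refine ⟨?_, ?_⟩
    · simp only [α, c]; rw [(τ1 q hq).1]; exact inv_mul_cancel₀ hc1.ne'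
    · simp [(τ1 q hq).2]
  · intro q hq
    have : α q = 0 := by
      simp only [α]
      rw [expNegInvGlue.zero_of_nonpos, mul_zero]
      have h1 : expNegInvGlue (3 / 4) ≤ expNegInvGlue (q - 1 / 4) :=
        expNegInvGlue.monotone (by linarith)
      have h2 : C * expNegInvGlue (3 / 4) ≤ C * expNegInvGlue (q - 1 / 4) :=
        mul_le_mul_of_nonneg_left h1 hC.le
      have h3 : C * expNegInvGlue (3 / 4) = 1 := inv_mul_cancel₀ hg0.ne'
      simp only [τ]; linarith
    exact ⟨this, by simp [this]⟩
  · intro q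
    have h := hα' q
    have hne := (hDpos q).ne'
    have hDq : D q = τ q ^ 2 - 2 * q * deriv τ q := rfl
    field_simp
    rw [hDq]
    linear_combination α q * h

end Cutoff

/-! ### Vector fields on a single vector space: flows, commutation, the Jacobi identity. -/

section NormedSpace

variable {F : Type*} [NormedAddCommGroup F] [NormedSpace ℝ F]

/-- A compactly supported C¹ field is bounded and globally Lipschitz, so Picard–Lindelöf applies on
arbitrarily long time intervals; the resulting curves patch to one on ℝ. -/
theorem exists_global_integral_curve [FiniteDimensional ℝ F] {f : F → F} (hf : ContDiff ℝ 1 f)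
    (hc : HasCompactSupport f) (x : F) :
    ∃ y : ℝ → F, y 0 = x ∧ ∀ t, HasDerivAt y (f (y t)) t := by
  have : CompleteSpace F := FiniteDimensional.complete ℝ F
  obtain ⟨K, hK⟩ := hf.lipschitzWith_of_hasCompactSupport hc one_ne_zero
  obtain ⟨C, hC⟩ := hc.exists_bound_of_continuous hf.continuous
  have hv : ContMDiff 𝓘(ℝ, F) 𝓘(ℝ, F).tangent 1
      (fun x => (⟨x, f x⟩ : TangentBundle 𝓘(ℝ, F) F)) :=
    contMDiff_vectorSpace_iff_contDiff.2 hf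
  have key : ∀ a, ∃ γ : ℝ → F, γ 0 = x ∧
      IsMIntegralCurveOn (I := 𝓘(ℝ, F)) γ f (Ioo (-a) a) := by
    intro a
    let T : ℝ := |a| + 1
    have hT : 0 < T := by positivity
    let L : NNReal := C.toNNReal
    -- With speed at most `L`, a curve cannot leave the ball of radius `L * T` before time `T`. As
    -- all bounds are global, this radius is not restricted.
    have hp : IsPicardLindelof (fun _ => f) (tmin := -T) (tmax := T)
        ⟨0, by simp [hT.le]⟩ x (L * T.toNNReal) 0 L K := by
      refine .of_time_independent (fun z _ => (hC z).trans (Real.le_coe_toNNReal C))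
        hK.lipschitzOnWith ?_
      simp [Real.coe_toNNReal T hT.le]
    obtain ⟨y, h0, hy⟩ := hp.exists_eq_forall_mem_Icc_hasDerivWithinAt₀
    refine ⟨y, h0, fun t ht => ?_⟩
    have ht' : t ∈ Ioo (-T) T := by
      have := le_abs_self a
      exact ⟨by simp only [T]; linarith [ht.1], by simp only [T]; linarith [ht.2]⟩
    have := (hy t (Ioo_subset_Icc_self ht')).hasDerivAt (Icc_mem_nhds ht'.1 ht'.2)
    have h' : HasFDerivAt y ((1 : ℝ →L[ℝ] ℝ).smulRight (f (y t))) t := this.hasFDerivAt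
    exact h'.hasMFDerivAt.hasMFDerivWithinAt
  obtain ⟨γ, h0, h⟩ := (exists_isMIntegralCurve_iff_exists_isMIntegralCurveOn_Ioo hv x).2 key
  refine ⟨γ, h0, fun t => ?_⟩
  have h1 : HasFDerivAt γ ((1 : ℝ →L[ℝ] ℝ).smulRight (f (γ t))) t :=
    hasMFDerivAt_iff_hasFDerivAt.1 (h t)
  simpa using h1.hasDerivAt

/-- The vector field `y ↦ α(q) v + β(q) B(y, v) y` with `q = B(y, y)`. -/
noncomputable def cutoffField (α β : ℝ → ℝ) (B : F →L[ℝ] F →L[ℝ] ℝ) (v y : F) : F :=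
  α (B y y) • v + (β (B y y) * B y v) • y

theorem fderiv_cutoffField {α β : ℝ → ℝ} (hα : Differentiable ℝ α) (hβ : Differentiable ℝ β)
    (B : F →L[ℝ] F →L[ℝ] ℝ) (hB : ∀ x y, B x y = B y x) (v y w : F) :
    fderiv ℝ (cutoffField α β B v) y w =
      (deriv α (B y y) * (2 * B y w)) • v +
        ((deriv β (B y y) * (2 * B y w) * B y v + β (B y y) * B w v) • y +
          (β (B y y) * B y v) • w) := by
  have hq : HasFDerivAt (fun y => B y y) ((2 : ℝ) • B y) y := by
    have := B.hasFDerivAt.clm_apply (hasFDerivAt_id (𝕜 := ℝ) y) (x := y)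
    refine this.congr_fderiv ?_
    ext z
    simp [hB z y, two_mul]
  have hv : HasFDerivAt (fun y => B y v) (B v) y := by
    have := (B v).hasFDerivAt (x := y)
    exact this.congr_of_eventuallyEq (Filter.Eventually.of_forall fun z => hB z v)
  have h1 := ((hα (B y y)).hasDerivAt.comp_hasFDerivAt (f := fun y => B y y) y hq).smul_const v
  have h2 := (((hβ (B y y)).hasDerivAt.comp_hasFDerivAt (f := fun y => B y y) y hq).mul hv).smul
    (hasFDerivAt_id (𝕜 := ℝ) y)
  have h3 : HasFDerivAt (cutoffField α β B v) _ y := h1.add h2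
  rw [h3.fderiv]
  simp [hB v w]
  module

/-- Both sides are combinations of v, w and y. The y-coefficients agree by symmetry of `B`; the v-
and w-coefficients differ by a multiple of the assumed equation. -/
theorem fderiv_cutoffField_comm {α β : ℝ → ℝ} (hα : Differentiable ℝ α)
    (hβ : Differentiable ℝ β) (h : ∀ q, 2 * deriv α q * (α q + β q * q) = α q * β q)
    (B : F →L[ℝ] F →L[ℝ] ℝ) (hB : ∀ x y, B x y = B y x) (v w y : F) :
    fderiv ℝ (cutoffField α β B w) y (cutoffField α β B v y) =
      fderiv ℝ (cutoffField α β B v) y (cutoffField α β B w y) := by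
  rw [fderiv_cutoffField hα hβ B hB, fderiv_cutoffField hα hβ B hB]
  simp only [cutoffField, map_add, map_smul, add_apply,
    smul_apply, smul_eq_mul]
  have hq := h (B y y)
  have hvw : B w v = B v w := hB w v
  rw [hvw]
  generalize B y y = q at *
  generalize B y v = a at *
  generalize B y w = b at *
  generalize B v w = c at *
  match_scalars
  · linear_combination a * hq
  · ring
  · linear_combination -b * hq

variable {ι : Type*} [Fintype ι]

/-- The bracket of functions on a vector space defined by `∑ Xᵢ ∧ Yᵢ`. -/
noncomputable def fieldBracket (X Y : ι → F → F) (f g : F → ℝ) (y : F) : ℝ :=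
  ∑ i, (fderiv ℝ f y (X i y) * fderiv ℝ g y (Y i y)
    - fderiv ℝ f y (Y i y) * fderiv ℝ g y (X i y))

/-- The iterated derivative `V (W f)`. -/
noncomputable def secondDeriv (V W : F → F) (f : F → ℝ) (y : F) : ℝ :=
  fderiv ℝ (fun z => fderiv ℝ f z (W z)) y (V y)

/-- V(Wf) splits into Df(DW·V) and D²f(V, W). The first term is symmetric by hypothesis, the second
by symmetry of second derivatives. -/
theorem secondDeriv_comm {V W : F → F} {f : F → ℝ} (hf : ContDiff ℝ ∞ f)
    (hV : Differentiable ℝ V) (hW : Differentiable ℝ W) (y : F)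
    (h : fderiv ℝ W y (V y) = fderiv ℝ V y (W y)) :
    secondDeriv V W f y = secondDeriv W V f y := by
  have hd : Differentiable ℝ (fderiv ℝ f) :=
    (hf.fderiv_right (m := ∞) (by simp)).differentiable (by simp)
  have key : ∀ {W : F → F}, Differentiable ℝ W → ∀ v,
      fderiv ℝ (fun z => fderiv ℝ f z (W z)) y v =
        fderiv ℝ f y (fderiv ℝ W y v) + fderiv ℝ (fderiv ℝ f) y v (W y) := fun {W} hW v => by
    rw [fderiv_clm_apply (hd y) (hW y)]
    simp
  have hs : IsSymmSndFDerivAt ℝ f y :=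
    (hf.contDiffAt (x := y)).isSymmSndFDerivAt (by
      rw [minSmoothness_of_isRCLikeNormedField]; exact WithTop.coe_le_coe.2 (le_top : (2 : ℕ∞) ≤ ⊤))
  rw [secondDeriv, secondDeriv, key hW, key hV, h, hs.eq]

theorem fieldBracket_fieldBracket {X Y : ι → F → F} (hX : ∀ i, Differentiable ℝ (X i))
    (hY : ∀ i, Differentiable ℝ (Y i)) {f g h : F → ℝ} (hg : ContDiff ℝ ∞ g)
    (hh : ContDiff ℝ ∞ h) (y : F) :
    fieldBracket X Y f (fieldBracket X Y g h) y =
      ∑ i, ∑ j, (fderiv ℝ f y (X i y) *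
          (secondDeriv (Y i) (X j) g y * fderiv ℝ h y (Y j y)
            + fderiv ℝ g y (X j y) * secondDeriv (Y i) (Y j) h y
            - secondDeriv (Y i) (Y j) g y * fderiv ℝ h y (X j y)
            - fderiv ℝ g y (Y j y) * secondDeriv (Y i) (X j) h y)
        - fderiv ℝ f y (Y i y) *
          (secondDeriv (X i) (X j) g y * fderiv ℝ h y (Y j y)
            + fderiv ℝ g y (X j y) * secondDeriv (X i) (Y j) h y
            - secondDeriv (X i) (Y j) g y * fderiv ℝ h y (X j y)
            - fderiv ℝ g y (Y j y) * secondDeriv (X i) (X j) h y)) := by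
  have hd : ∀ {f : F → ℝ}, ContDiff ℝ ∞ f → ∀ {W : F → F}, Differentiable ℝ W →
      DifferentiableAt ℝ (fun z => fderiv ℝ f z (W z)) y := fun {f} hf {W} hW =>
    (((hf.fderiv_right (m := ∞) (by simp)).differentiable (by simp)) y).clm_apply (hW y)
  have key : ∀ V : F → F, fderiv ℝ (fieldBracket X Y g h) y (V y) =
      ∑ j, (secondDeriv V (X j) g y * fderiv ℝ h y (Y j y)
            + fderiv ℝ g y (X j y) * secondDeriv V (Y j) h y
            - secondDeriv V (Y j) g y * fderiv ℝ h y (X j y)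
            - fderiv ℝ g y (Y j y) * secondDeriv V (X j) h y) := by
    intro V
    have h1 : HasFDerivAt (fieldBracket X Y g h) _ y := HasFDerivAt.fun_sum fun i _ =>
      ((hd hg (hX i)).hasFDerivAt.mul (hd hh (hY i)).hasFDerivAt).sub
        ((hd hg (hY i)).hasFDerivAt.mul (hd hh (hX i)).hasFDerivAt)
    rw [h1.fderiv, sum_apply]
    refine Finset.sum_congr rfl fun j _ => ?_
    simp [secondDeriv]
    ring
  rw [fieldBracket]
  refine Finset.sum_congr rfl fun i _ => ?_
  rw [key, key, Finset.mul_sum, Finset.mul_sum, ← Finset.sum_sub_distrib]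

/-- The cyclic sum is a double sum over (i, j). Once the iterated derivatives commute, its summand
is antisymmetric in i and j, so the sum vanishes. -/
theorem fieldBracket_jacobi {X Y : ι → F → F} (hX : ∀ i, Differentiable ℝ (X i))
    (hY : ∀ i, Differentiable ℝ (Y i)) {f g h : F → ℝ} (hf : ContDiff ℝ ∞ f)
    (hg : ContDiff ℝ ∞ g) (hh : ContDiff ℝ ∞ h) (y : F)
    (hXX : ∀ i j, fderiv ℝ (X j) y (X i y) = fderiv ℝ (X i) y (X j y))
    (hXY : ∀ i j, fderiv ℝ (Y j) y (X i y) = fderiv ℝ (X i) y (Y j y))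
    (hYY : ∀ i j, fderiv ℝ (Y j) y (Y i y) = fderiv ℝ (Y i) y (Y j y)) :
    fieldBracket X Y f (fieldBracket X Y g h) y + fieldBracket X Y g (fieldBracket X Y h f) y
      + fieldBracket X Y h (fieldBracket X Y f g) y = 0 := by
  rw [fieldBracket_fieldBracket hX hY hg hh, fieldBracket_fieldBracket hX hY hh hf,
    fieldBracket_fieldBracket hX hY hf hg]
  simp only [← Finset.sum_add_distrib]
  have cXX : ∀ {k : F → ℝ}, ContDiff ℝ ∞ k → ∀ i j,
      secondDeriv (X i) (X j) k y = secondDeriv (X j) (X i) k y := fun hk i j =>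
    secondDeriv_comm hk (hX i) (hX j) y (hXX i j)
  have cYY : ∀ {k : F → ℝ}, ContDiff ℝ ∞ k → ∀ i j,
      secondDeriv (Y i) (Y j) k y = secondDeriv (Y j) (Y i) k y := fun hk i j =>
    secondDeriv_comm hk (hY i) (hY j) y (hYY i j)
  have cXY : ∀ {k : F → ℝ}, ContDiff ℝ ∞ k → ∀ i j,
      secondDeriv (X i) (Y j) k y = secondDeriv (Y j) (X i) k y := fun hk i j =>
    secondDeriv_comm hk (hX i) (hY j) y (hXY i j)
  have anti : ∀ {K : ι → ι → ℝ}, (∀ i j, K i j + K j i = 0) → ∑ i, ∑ j, K i j = 0 := by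
    intro K hK
    have h1 : ∑ i, ∑ j, K i j + ∑ i, ∑ j, K j i = 0 := by
      simp only [← Finset.sum_add_distrib, hK, Finset.sum_const_zero]
    rw [Finset.sum_comm (f := fun i j => K j i)] at h1
    linarith
  refine anti fun i j => ?_
  rw [cXX hf i j, cXX hg i j, cXX hh i j, cYY hf i j, cYY hg i j, cYY hh i j,
    cXY hf i j, cXY hg i j, cXY hh i j, cXY hf j i, cXY hg j i, cXY hh j i]
  ring

theorem isCompact_setOf_form_le_one [FiniteDimensional ℝ F] (B : F →L[ℝ] F →L[ℝ] ℝ)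
    (hB : ∀ x, x ≠ 0 → 0 < B x x) : IsCompact {x | B x x ≤ 1} := by
  have hcont : Continuous fun x => B x x := B.continuous.clm_apply continuous_id
  have : ProperSpace F := FiniteDimensional.proper_real F
  refine Metric.isCompact_of_isClosed_isBounded (isClosed_le hcont continuous_const) ?_
  -- The unit sphere is empty only when the space is zero; otherwise the minimum of the form on it
  -- controls the norm.
  rcases (Metric.sphere (0 : F) 1).eq_empty_or_nonempty with he | hne
  · refine (Metric.isBounded_closedBall (x := (0 : F)) (r := 0)).subset fun x _ => ?_
    by_contra hx
    have hx0 : x ≠ 0 := fun h => hx (by simp [h])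
    have : (‖x‖⁻¹ • x) ∈ Metric.sphere (0 : F) 1 := by
      simp [norm_smul, inv_mul_cancel₀ (norm_ne_zero_iff.2 hx0)]
    rw [he] at this
    exact this
  · obtain ⟨z, hz, hmin⟩ := (isCompact_sphere (0 : F) 1).exists_isMinOn hne hcont.continuousOn
    have hz1 : ‖z‖ = 1 := by simpa using hz
    have hm : 0 < B z z := hB z (norm_ne_zero_iff.1 (by rw [hz1]; exact one_ne_zero))
    -- From ‖x‖² ≤ 1 / B(z, z) this radius bounds ‖x‖ without taking a square root.
    refine (Metric.isBounded_closedBall (x := (0 : F)) (r := 1 + (B z z)⁻¹)).subset fun x hx => ?_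
    rw [mem_closedBall_zero_iff]
    by_cases hx0 : x = 0
    · simp [hx0]; positivity
    have hn : 0 < ‖x‖ := norm_pos_iff.2 hx0
    have h1 : B z z ≤ B (‖x‖⁻¹ • x) (‖x‖⁻¹ • x) := hmin (by
      simp [norm_smul, inv_mul_cancel₀ hn.ne'])
    simp only [map_smul, smul_apply, smul_eq_mul] at h1
    have h2 : B z z * ‖x‖ ^ 2 ≤ B x x := by
      have := mul_le_mul_of_nonneg_right h1 (sq_nonneg ‖x‖)
      field_simp at this
      linarith
    have h3 : ‖x‖ ^ 2 ≤ (B z z)⁻¹ := by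
      rw [le_inv_comm₀ (by positivity) hm, ← one_div, le_div_iff₀ (by positivity)]
      exact h2.trans hx
    nlinarith [sq_nonneg (‖x‖ - 1), inv_pos.2 hm]

end NormedSpace

/-! ### Vertical calculus on the total space, read in the model fibre. -/

section Fiber

variable {EM : Type*} [NormedAddCommGroup EM] [NormedSpace ℝ EM]
  {M : Type*} [TopologicalSpace M] [ChartedSpace EM M]
  {F : Type*} [NormedAddCommGroup F] [NormedSpace ℝ F]
  (E : M → Type*) [TopologicalSpace (TotalSpace F E)]
  [∀ p, AddCommGroup (E p)] [∀ p, Module ℝ (E p)] [∀ p, TopologicalSpace (E p)]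
  [FiberBundle F E] [VectorBundle ℝ F E]

variable (F) in
/-- The identification of the fibre at `p` with the model fibre. -/
noncomputable def fiberEquiv (p : M) : E p ≃L[ℝ] F :=
  VectorBundle.continuousLinearEquivAt ℝ F E p

variable {E} in
theorem fiberEquiv_apply (p : M) (v : E p) :
    fiberEquiv F E p v = (trivializationAt F E p ⟨p, v⟩).2 := by
  rw [fiberEquiv, VectorBundle.continuousLinearEquivAt,
    Trivialization.coe_continuousLinearEquivAt_eq]
  exact Trivialization.continuousLinearMapAt_apply_of_mem ℝ _
    (FiberBundle.mem_baseSet_trivializationAt' p) v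

variable (F) in
/-- The inclusion of the fibre at `p` into the total space, with domain the model fibre. -/
noncomputable def fiberIncl (p : M) (y : F) : TotalSpace F E := ⟨p, (fiberEquiv F E p).symm y⟩

variable {E}

theorem fiberIncl_fiberEquiv (e : TotalSpace F E) :
    fiberIncl F E e.proj (fiberEquiv F E e.proj e.2) = e := by
  simp [fiberIncl]

theorem trivializationAt_fiberIncl (p : M) (y : F) :
    trivializationAt F E p (fiberIncl F E p y) = (p, y) := by
  refine Prod.ext ?_ ?_
  · exact Trivialization.coe_fst' _ (FiberBundle.mem_baseSet_trivializationAt' p)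
  · rw [fiberIncl, ← fiberEquiv_apply, ContinuousLinearEquiv.apply_symm_apply]

theorem contMDiff_fiberIncl (p : M) :
    ContMDiff 𝓘(ℝ, F) (𝓘(ℝ, EM).prod 𝓘(ℝ, F)) ∞ (fiberIncl F E p) := by
  intro y
  rw [contMDiffAt_totalSpace]
  refine ⟨contMDiffAt_const, ?_⟩
  have : (fun z => (trivializationAt F E (fiberIncl F E p y).proj (fiberIncl F E p z)).2) = id := by
    funext z
    exact congrArg Prod.snd (trivializationAt_fiberIncl p z)
  rw [this]
  exact contMDiffAt_id

/-- The preferred chart at a point over p uses the same trivialisation that identifies the fibre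
with `F`. Hence the inclusion of the fibre becomes an affine slice, with derivative `inr`. -/
theorem extChartAt_fiberIncl (p : M) (y z : F) :
    extChartAt (𝓘(ℝ, EM).prod 𝓘(ℝ, F)) (fiberIncl F E p y) (fiberIncl F E p z) =
      (extChartAt 𝓘(ℝ, EM) p p, z) := by
  rw [FiberBundle.extChartAt]
  change ((extChartAt 𝓘(ℝ, EM) p).prod (PartialEquiv.refl F))
    (trivializationAt F E p (fiberIncl F E p z)) = _
  rw [trivializationAt_fiberIncl]
  rfl

theorem hasMFDerivAt_fiberIncl (p : M) (y : F) :
    HasMFDerivAt 𝓘(ℝ, F) (𝓘(ℝ, EM).prod 𝓘(ℝ, F)) (fiberIncl F E p) y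
      (ContinuousLinearMap.inr ℝ EM F) := by
  refine ⟨(contMDiff_fiberIncl (EM := EM) p).continuous.continuousAt, ?_⟩
  have hw : writtenInExtChartAt 𝓘(ℝ, F) (𝓘(ℝ, EM).prod 𝓘(ℝ, F)) y (fiberIncl F E p) =
      fun z : F => (extChartAt 𝓘(ℝ, EM) p p, z) := by
    funext z
    exact extChartAt_fiberIncl p y z
  rw [hw]
  exact ((hasFDerivAt_const _ _).prodMk (hasFDerivAt_id _)).hasFDerivWithinAt

theorem vertLift_fiberIncl (p : M) (y w : F) :
    vertLift 𝓘(ℝ, EM) (fiberIncl F E p y) ((fiberEquiv F E p).symm w) = ((0, w) : EM × F) := by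
  refine (vertLiftVec_eq _ _ _).trans (Prod.ext rfl ?_)
  have hb : p ∈ (trivializationAt F E p).baseSet := FiberBundle.mem_baseSet_trivializationAt' p
  change (trivializationAt F E p).linearMapAt ℝ p _ = w
  rw [Trivialization.coe_linearMapAt_of_mem _ hb]
  change (trivializationAt F E p ⟨p, _⟩).2 = w
  rw [← fiberEquiv_apply]
  exact ContinuousLinearEquiv.apply_symm_apply _ _

/-- The derivative of a map along a vertical vector is computed on the fibre. -/
theorem mfderiv_vertLift {G : Type*} [NormedAddCommGroup G] [NormedSpace ℝ G]
    {f : TotalSpace F E → G} {e : TotalSpace F E}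
    (hf : MDifferentiableAt (𝓘(ℝ, EM).prod 𝓘(ℝ, F)) 𝓘(ℝ, G) f e) (v : E e.proj) :
    mfderiv (𝓘(ℝ, EM).prod 𝓘(ℝ, F)) 𝓘(ℝ, G) f e (vertLift 𝓘(ℝ, EM) e v) =
      fderiv ℝ (fun y => f (fiberIncl F E e.proj y)) (fiberEquiv F E e.proj e.2)
        (fiberEquiv F E e.proj v) := by
  obtain ⟨p, x⟩ := e
  obtain ⟨y, rfl⟩ := (fiberEquiv F E p).symm.surjective x
  obtain ⟨w, rfl⟩ := (fiberEquiv F E p).symm.surjective v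
  change mfderiv (𝓘(ℝ, EM).prod 𝓘(ℝ, F)) 𝓘(ℝ, G) f (fiberIncl F E p y)
    (vertLift 𝓘(ℝ, EM) (fiberIncl F E p y) ((fiberEquiv F E p).symm w)) = _
  rw [vertLift_fiberIncl]
  have h := (hf.hasMFDerivAt (x := fiberIncl F E p y)).comp y
    (hasMFDerivAt_fiberIncl (EM := EM) p y)
  have h' : HasFDerivAt (fun y => f (fiberIncl F E p y)) (ContinuousLinearMap.comp
      (show EM × F →L[ℝ] G from mfderiv (𝓘(ℝ, EM).prod 𝓘(ℝ, F)) 𝓘(ℝ, G) f (fiberIncl F E p y))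
      (ContinuousLinearMap.inr ℝ EM F)) y := hasMFDerivAt_iff_hasFDerivAt.1 h
  simp only [ContinuousLinearEquiv.apply_symm_apply]
  rw [h'.fderiv]
  rfl

theorem mfderiv_extChartAt_vertLift [IsManifold 𝓘(ℝ, EM) ∞ M] [ContMDiffVectorBundle ∞ F E 𝓘(ℝ, EM)]
    {e₀ e : TotalSpace F E}
    (he : e ∈ (extChartAt (𝓘(ℝ, EM).prod 𝓘(ℝ, F)) e₀).source) (v : E e.proj) :
    mfderiv (𝓘(ℝ, EM).prod 𝓘(ℝ, F)) 𝓘(ℝ, EM × F) (extChartAt (𝓘(ℝ, EM).prod 𝓘(ℝ, F)) e₀) e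
      (vertLift 𝓘(ℝ, EM) e v) =
      ((0, (trivializationAt F E e₀.proj ⟨e.proj, v⟩).2) : EM × F) := by
  have hs : e ∈ (trivializationAt F E e₀.proj).source := by
    rw [FiberBundle.extChartAt] at he
    exact he.1
  have hb : e.proj ∈ (trivializationAt F E e₀.proj).baseSet :=
    (Trivialization.mem_source _).1 hs
  rw [mfderiv_vertLift (mdifferentiableAt_extChartAt (by rwa [extChartAt_source] at he))]
  -- The change of trivialisation over `e.proj`. Along this fibre the chart at `e₀` is constant in
  -- the base direction and equals `A` in the fibre direction.
  let A : F →L[ℝ] F := ((trivializationAt F E e₀.proj).continuousLinearMapAt ℝ e.proj).comp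
    (fiberEquiv F E e.proj).symm.toContinuousLinearMap
  have hA : ∀ y, extChartAt (𝓘(ℝ, EM).prod 𝓘(ℝ, F)) e₀ (fiberIncl F E e.proj y) =
      (extChartAt 𝓘(ℝ, EM) e₀.proj e.proj, A y) := fun y => by
    have h1 : trivializationAt F E e₀.proj (fiberIncl F E e.proj y) = (e.proj, A y) := by
      refine Prod.ext (Trivialization.coe_fst' _ hb) ?_
      exact (Trivialization.continuousLinearMapAt_apply_of_mem ℝ _ hb _).symm
    rw [FiberBundle.extChartAt]
    change ((extChartAt 𝓘(ℝ, EM) e₀.proj).prod (PartialEquiv.refl F))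
      (trivializationAt F E e₀.proj (fiberIncl F E e.proj y)) = _
    rw [h1]
    rfl
  simp only [hA]
  rw [((hasFDerivAt_const _ _).prodMk A.hasFDerivAt).fderiv]
  refine Prod.ext rfl ?_
  change A (fiberEquiv F E e.proj v) = _
  simp only [A, ContinuousLinearMap.comp_apply, ContinuousLinearEquiv.coe_coe,
    ContinuousLinearEquiv.symm_apply_apply]
  exact Trivialization.continuousLinearMapAt_apply_of_mem ℝ _ hb v

theorem isSmoothVectorField_vertLift [IsManifold 𝓘(ℝ, EM) ∞ M]
    [ContMDiffVectorBundle ∞ F E 𝓘(ℝ, EM)] {ν : ∀ e : TotalSpace F E, E e.proj}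
    (hν : ContMDiff (𝓘(ℝ, EM).prod 𝓘(ℝ, F)) (𝓘(ℝ, EM).prod 𝓘(ℝ, F)) ∞
      fun e => (⟨e.proj, ν e⟩ : TotalSpace F E)) :
    IsSmoothVectorField (𝓘(ℝ, EM).prod 𝓘(ℝ, F)) fun e => vertLift 𝓘(ℝ, EM) e (ν e) := by
  intro e₀
  rw [contMDiffAt_section]
  have h := (contMDiffAt_totalSpace.1 (hν e₀)).2
  refine ContMDiffAt.congr_of_eventuallyEq
    (f := fun e => ((0, (trivializationAt F E e₀.proj ⟨e.proj, ν e⟩).2) : EM × F))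
    (contMDiffAt_const.prodMk_space h) ?_
  filter_upwards [extChartAt_source_mem_nhds (I := 𝓘(ℝ, EM).prod 𝓘(ℝ, F)) e₀] with e he
  have he' : e ∈ (chartAt (ModelProd EM F) e₀).source := by rwa [extChartAt_source] at he
  have hb : e ∈ (trivializationAt (EM × F) (TangentSpace (𝓘(ℝ, EM).prod 𝓘(ℝ, F))) e₀).baseSet := he'
  rw [← mfderiv_extChartAt_vertLift he, ← TangentBundle.continuousLinearMapAt_trivializationAt he']
  exact (Trivialization.continuousLinearMapAt_apply_of_mem ℝ _ hb _).symm

end Fiber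

/-! ### Lie brackets of vertical fields and smoothness of sums of wedges. -/

section Fiber

variable {EM : Type*} [NormedAddCommGroup EM] [NormedSpace ℝ EM]
  {M : Type*} [TopologicalSpace M] [ChartedSpace EM M]
  {F : Type*} [NormedAddCommGroup F] [NormedSpace ℝ F]
  {E : M → Type*} [TopologicalSpace (TotalSpace F E)]
  [∀ p, AddCommGroup (E p)] [∀ p, Module ℝ (E p)] [∀ p, TopologicalSpace (E p)]
  [FiberBundle F E] [VectorBundle ℝ F E]

/-- The restriction to the fibre at `p` of a fibrewise map, read in the model fibre. -/
noncomputable def fiberField (ν : ∀ e : TotalSpace F E, E e.proj) (p : M) (y : F) : F :=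
  fiberEquiv F E p (ν (fiberIncl F E p y))

theorem contDiff_fiberField [IsManifold 𝓘(ℝ, EM) ∞ M]
    [ContMDiffVectorBundle ∞ F E 𝓘(ℝ, EM)] {ν : ∀ e : TotalSpace F E, E e.proj}
    (hν : ContMDiff (𝓘(ℝ, EM).prod 𝓘(ℝ, F)) (𝓘(ℝ, EM).prod 𝓘(ℝ, F)) ∞
      fun e => (⟨e.proj, ν e⟩ : TotalSpace F E)) (p : M) :
    ContDiff ℝ ∞ (fiberField ν p) := by
  rw [← contMDiff_iff_contDiff]
  intro y
  have h := (hν.comp (contMDiff_fiberIncl (EM := EM) (E := E) p)) y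
  refine ((contMDiffAt_totalSpace.1 h).2).congr_of_eventuallyEq (Filter.Eventually.of_forall ?_)
  intro z
  exact fiberEquiv_apply _ _

/-- In a chart the bracket is DW(V) - DV(W). Since V and W take vertical values, only their
derivatives along the fibre enter, and these are the derivatives of the fibre fields. -/
theorem mlieBracket_vertLift_eq_zero [FiniteDimensional ℝ EM] [FiniteDimensional ℝ F]
    [IsManifold 𝓘(ℝ, EM) ∞ M]
    [ContMDiffVectorBundle ∞ F E 𝓘(ℝ, EM)] {ν μ : ∀ e : TotalSpace F E, E e.proj}
    (hν : ContMDiff (𝓘(ℝ, EM).prod 𝓘(ℝ, F)) (𝓘(ℝ, EM).prod 𝓘(ℝ, F)) ∞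
      fun e => (⟨e.proj, ν e⟩ : TotalSpace F E))
    (hμ : ContMDiff (𝓘(ℝ, EM).prod 𝓘(ℝ, F)) (𝓘(ℝ, EM).prod 𝓘(ℝ, F)) ∞
      fun e => (⟨e.proj, μ e⟩ : TotalSpace F E))
    (h : ∀ p y, fderiv ℝ (fiberField μ p) y (fiberField ν p y) =
      fderiv ℝ (fiberField ν p) y (fiberField μ p y)) :
    Commute (𝓘(ℝ, EM).prod 𝓘(ℝ, F)) (fun e => vertLift 𝓘(ℝ, EM) e (ν e))
      (fun e => vertLift 𝓘(ℝ, EM) e (μ e)) := by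
  intro e₀
  obtain ⟨p, x⟩ := e₀
  obtain ⟨y, rfl⟩ := (fiberEquiv F E p).symm.surjective x
  have : CompleteSpace (EM × F) := FiniteDimensional.complete ℝ _
  have hcoord : ∀ {ν : ∀ e : TotalSpace F E, E e.proj},
      ContMDiff (𝓘(ℝ, EM).prod 𝓘(ℝ, F)) (𝓘(ℝ, EM).prod 𝓘(ℝ, F)) ∞
        (fun e => (⟨e.proj, ν e⟩ : TotalSpace F E)) →
      ∃ V : EM × F → EM × F, V = VectorField.mpullbackWithin 𝓘(ℝ, EM × F)
          (𝓘(ℝ, EM).prod 𝓘(ℝ, F)) (extChartAt (𝓘(ℝ, EM).prod 𝓘(ℝ, F)) (fiberIncl F E p y)).symm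
          (fun e => vertLift 𝓘(ℝ, EM) e (ν e)) (range (𝓘(ℝ, EM).prod 𝓘(ℝ, F))) ∧
        V (extChartAt 𝓘(ℝ, EM) p p, y) = (0, fiberField ν p y) ∧
        ∀ w, fderiv ℝ V (extChartAt 𝓘(ℝ, EM) p p, y) (0, w) =
          (0, fderiv ℝ (fiberField ν p) y w) := by
    intro ν hν
    refine ⟨_, rfl, ?_⟩
    set V : EM × F → EM × F := VectorField.mpullbackWithin 𝓘(ℝ, EM × F)
          (𝓘(ℝ, EM).prod 𝓘(ℝ, F)) (extChartAt (𝓘(ℝ, EM).prod 𝓘(ℝ, F)) (fiberIncl F E p y)).symm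
          (fun e => vertLift 𝓘(ℝ, EM) e (ν e)) (range (𝓘(ℝ, EM).prod 𝓘(ℝ, F))) with hV
    have hval : ∀ z, V (extChartAt 𝓘(ℝ, EM) p p, z) = (0, fiberField ν p z) := by
      intro z
      have hsrc : fiberIncl F E p z ∈
          (extChartAt (𝓘(ℝ, EM).prod 𝓘(ℝ, F)) (fiberIncl F E p y)).source := by
        rw [FiberBundle.extChartAt]
        refine ⟨(Trivialization.mem_source _).2
          (FiberBundle.mem_baseSet_trivializationAt' p), ?_⟩
        change trivializationAt F E p (fiberIncl F E p z) ∈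
          ((extChartAt 𝓘(ℝ, EM) p).prod (PartialEquiv.refl F)).source
        rw [trivializationAt_fiberIncl]
        exact ⟨mem_extChartAt_source p, mem_univ _⟩
      have hx := extChartAt_fiberIncl (EM := EM) (E := E) p y z
      -- The pullback is defined through the inverse of the derivative of the inverse chart, which
      -- is the derivative of the chart itself.
      have hinv := ContinuousLinearMap.inverse_eq
        (mfderivWithin_extChartAt_symm_comp_mfderiv_extChartAt'
          (I := 𝓘(ℝ, EM).prod 𝓘(ℝ, F)) hsrc)
        (mfderiv_extChartAt_comp_mfderivWithin_extChartAt_symm' hsrc)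
      have h1 := mfderiv_extChartAt_vertLift (EM := EM) hsrc (ν (fiberIncl F E p z))
      rw [hV, VectorField.mpullbackWithin_apply, ← hx]
      have h2 := (extChartAt (𝓘(ℝ, EM).prod 𝓘(ℝ, F)) (fiberIncl F E p y)).left_inv hsrc
      refine Eq.trans ?_ (h1.trans (Prod.ext rfl (fiberEquiv_apply p _).symm))
      rw [← hinv]
      have h3 := congrArg (fun e => (vertLift 𝓘(ℝ, EM) e (ν e) : EM × F)) h2
      exact congrArg (fun w : EM × F => ContinuousLinearMap.inverse
        (mfderivWithin 𝓘(ℝ, EM × F) (𝓘(ℝ, EM).prod 𝓘(ℝ, F)) (extChartAt (𝓘(ℝ, EM).prod 𝓘(ℝ, F)) (fiberIncl F E p y)).symm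
        (range (𝓘(ℝ, EM).prod 𝓘(ℝ, F)))
        (extChartAt (𝓘(ℝ, EM).prod 𝓘(ℝ, F)) (fiberIncl F E p y) (fiberIncl F E p z))) w) h3
    refine ⟨hval y, fun w => ?_⟩
    have hd : DifferentiableAt ℝ V (extChartAt 𝓘(ℝ, EM) p p, y) := by
      have h1 := (isSmoothVectorField_vertLift hν (fiberIncl F E p y)).mdifferentiableAt (by simp)
      have h2 := (MDifferentiableAt.mdifferentiableWithinAt (s := univ)
        h1).differentiableWithinAt_mpullbackWithin_vectorField
      have hr : range (𝓘(ℝ, EM).prod 𝓘(ℝ, F)) = univ := ModelWithCorners.range_eq_univ _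
      rw [extChartAt_fiberIncl, preimage_univ, univ_inter] at h2
      rw [← differentiableWithinAt_univ, ← hr]
      exact h2
    have h3 : HasFDerivAt (fun z => ((0, fiberField ν p z) : EM × F)) _ y :=
      ((hasFDerivAt_const (0 : EM) y).prodMk
        ((contDiff_fiberField (EM := EM) hν p).differentiable (by simp) y).hasFDerivAt)
    have h4 := hd.hasFDerivAt.comp y
      ((hasFDerivAt_const (extChartAt 𝓘(ℝ, EM) p p) y).prodMk (hasFDerivAt_id (𝕜 := ℝ) y))
    have h5 := (h4.congr_of_eventuallyEq (Filter.Eventually.of_forall fun z =>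
      (hval z).symm)).unique h3
    exact congrArg (fun A : F →L[ℝ] EM × F => A w) h5
  obtain ⟨V, hV, hV1, hV2⟩ := hcoord hν
  obtain ⟨W, hW, hW1, hW2⟩ := hcoord hμ
  change VectorField.mlieBracketWithin (𝓘(ℝ, EM).prod 𝓘(ℝ, F)) _ _ univ (fiberIncl F E p y) = 0
  rw [VectorField.mlieBracketWithin_apply, ← hV, ← hW]
  have key : VectorField.lieBracketWithin ℝ V W
      ((extChartAt (𝓘(ℝ, EM).prod 𝓘(ℝ, F)) (fiberIncl F E p y)).symm ⁻¹' univ ∩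
        range (𝓘(ℝ, EM).prod 𝓘(ℝ, F)))
      (extChartAt (𝓘(ℝ, EM).prod 𝓘(ℝ, F)) (fiberIncl F E p y) (fiberIncl F E p y)) = 0 := by
    have hr : range (𝓘(ℝ, EM).prod 𝓘(ℝ, F)) = univ := ModelWithCorners.range_eq_univ _
    rw [hr, preimage_univ, inter_univ, VectorField.lieBracketWithin_univ, VectorField.lieBracket,
      extChartAt_fiberIncl, hV1, hW1, hV2, hW2, h, sub_self]
  rw [key]
  exact ContinuousLinearMap.map_zero _

variable {ι : Type*} [Fintype ι]

theorem isSmoothBivectorSection_sum_wedge {N : Type*} {EN : Type*} [NormedAddCommGroup EN]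
    [NormedSpace ℝ EN] [FiniteDimensional ℝ EN] {HN : Type*} [TopologicalSpace HN]
    (IN : ModelWithCorners ℝ EN HN) [TopologicalSpace N] [ChartedSpace HN N] [IsManifold IN ∞ N]
    {X Y : ι → ∀ e : N, TangentSpace IN e} (hX : ∀ i, IsSmoothVectorField IN (X i))
    (hY : ∀ i, IsSmoothVectorField IN (Y i)) :
    IsSmoothBivectorSection IN EN (TangentSpace IN : N → Type _)
      (fun e => ∑ i, wedge (X i e) (Y i e)) := by
  intro x₀ ℓ
  let T := trivializationAt EN (TangentSpace IN : N → Type _) x₀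
  let B : EN →L[ℝ] EN →L[ℝ] ℝ := ((wedgeₗ EN).compr₂ ℓ).toContinuousBilinearMap
  have hsec : ∀ {Z : ∀ e : N, TangentSpace IN e}, IsSmoothVectorField IN Z →
      ContMDiffOn IN 𝓘(ℝ, EN) ∞ (fun e => (T ⟨e, Z e⟩).2) T.baseSet := fun hZ =>
    (T.contMDiffOn_section_baseSet_iff).1 hZ.contMDiffOn
  have h : ContMDiffOn IN 𝓘(ℝ, ℝ) ∞
      (fun e => ∑ i, B (T ⟨e, X i e⟩).2 (T ⟨e, Y i e⟩).2) T.baseSet := by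
    refine contMDiffOn_finsetSum fun i _ => ?_
    exact ((B.contDiff.contMDiff.comp_contMDiffOn (hsec (hX i))).clm_apply (hsec (hY i)))
  refine h.congr fun e he => ?_
  simp only [map_sum, map_wedge]
  refine Finset.sum_congr rfl fun i _ => ?_
  rw [Trivialization.coe_linearMapAt_of_mem _ he]
  rfl

/-- The derivative `X f` of a function along a vector field. -/
noncomputable def dirDeriv {N : Type*} {EN : Type*} [NormedAddCommGroup EN]
    [NormedSpace ℝ EN] {HN : Type*} [TopologicalSpace HN]
    (IN : ModelWithCorners ℝ EN HN) [TopologicalSpace N] [ChartedSpace HN N]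
    (X : ∀ e : N, TangentSpace IN e) (f : N → ℝ) (e : N) : ℝ :=
  mfderiv IN 𝓘(ℝ, ℝ) f e (X e)

theorem contMDiff_dirDeriv {N : Type*} {EN : Type*} [NormedAddCommGroup EN]
    [NormedSpace ℝ EN] {HN : Type*} [TopologicalSpace HN]
    (IN : ModelWithCorners ℝ EN HN) [TopologicalSpace N] [ChartedSpace HN N] [IsManifold IN ∞ N]
    {X : ∀ e : N, TangentSpace IN e} (hX : IsSmoothVectorField IN X)
    {f : N → ℝ} (hf : ContMDiff IN 𝓘(ℝ, ℝ) ∞ f) :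
    ContMDiff IN 𝓘(ℝ, ℝ) ∞ (dirDeriv IN X f) := by
  have h1 := (hf.contMDiff_tangentMap (m := ∞) (by simp)).comp hX
  exact (contMDiff_snd_tangentBundle_modelSpace ℝ 𝓘(ℝ, ℝ)).comp h1

theorem poissonBracket_sum_wedge {N : Type*} {EN : Type*} [NormedAddCommGroup EN]
    [NormedSpace ℝ EN] {HN : Type*} [TopologicalSpace HN]
    (IN : ModelWithCorners ℝ EN HN) [TopologicalSpace N] [ChartedSpace HN N]
    (X Y : ι → ∀ e : N, TangentSpace IN e) (f g : N → ℝ) (e : N) :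
    poissonBracket IN (fun e => ∑ i, wedge (X i e) (Y i e)) f g e =
      ∑ i, (dirDeriv IN (X i) f e * dirDeriv IN (Y i) g e -
        dirDeriv IN (Y i) f e * dirDeriv IN (X i) g e) := by
  rw [poissonBracket]
  simp only [map_sum]
  refine Finset.sum_congr rfl fun i _ => ?_
  exact pairingDual_wedge_wedge _ _ _ _

end Fiber

/-! ### Completeness, verticality and the Poisson property from fibrewise data. -/

section Fiber

variable {EM : Type*} [NormedAddCommGroup EM] [NormedSpace ℝ EM]
  {M : Type*} [TopologicalSpace M] [ChartedSpace EM M]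
  {F : Type*} [NormedAddCommGroup F] [NormedSpace ℝ F]
  {E : M → Type*} [TopologicalSpace (TotalSpace F E)]
  [∀ p, AddCommGroup (E p)] [∀ p, Module ℝ (E p)] [∀ p, TopologicalSpace (E p)]
  [FiberBundle F E] [VectorBundle ℝ F E]

theorem vertLift_fiberIncl_eq (ν : ∀ e : TotalSpace F E, E e.proj) (p : M) (y : F) :
    vertLift 𝓘(ℝ, EM) (fiberIncl F E p y) (ν (fiberIncl F E p y)) =
      ((0, fiberField ν p y) : EM × F) := by
  have h := vertLift_fiberIncl (EM := EM) (E := E) p y (fiberField ν p y)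
  exact (congrArg (fun v : E p => (vertLift 𝓘(ℝ, EM) (fiberIncl F E p y) v : EM × F))
    ((fiberEquiv F E p).symm_apply_apply (ν (fiberIncl F E p y))).symm).trans h

theorem isCompleteVectorField_vertLift [FiniteDimensional ℝ F] [IsManifold 𝓘(ℝ, EM) ∞ M]
    [ContMDiffVectorBundle ∞ F E 𝓘(ℝ, EM)] {ν : ∀ e : TotalSpace F E, E e.proj}
    (hν : ContMDiff (𝓘(ℝ, EM).prod 𝓘(ℝ, F)) (𝓘(ℝ, EM).prod 𝓘(ℝ, F)) ∞
      fun e => (⟨e.proj, ν e⟩ : TotalSpace F E))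
    (hc : ∀ p, HasCompactSupport (fiberField ν p)) :
    IsCompleteVectorField (𝓘(ℝ, EM).prod 𝓘(ℝ, F)) fun e => vertLift 𝓘(ℝ, EM) e (ν e) := by
  intro e
  obtain ⟨y, h0, hy⟩ := exists_global_integral_curve
    ((contDiff_fiberField (EM := EM) hν e.proj).of_le (by simp)) (hc e.proj)
    (fiberEquiv F E e.proj e.2)
  refine ⟨fun t => fiberIncl F E e.proj (y t), ?_, fun t => ?_⟩
  · change fiberIncl F E e.proj (y 0) = e
    rw [h0, fiberIncl_fiberEquiv]
  · have h1 : HasFDerivAt y ((1 : ℝ →L[ℝ] ℝ).smulRight (fiberField ν e.proj (y t))) t :=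
      (hy t).hasFDerivAt
    have h2 := (hasMFDerivAt_fiberIncl (EM := EM) (E := E) e.proj (y t)).comp t h1.hasMFDerivAt
    refine h2.congr_mfderiv ?_
    refine ContinuousLinearMap.ext fun (r : ℝ) => ?_
    have h3 := vertLift_fiberIncl_eq (EM := EM) ν e.proj (y t)
    change ((0, r • fiberField ν e.proj (y t)) : EM × F) =
      r • (show EM × F from
        vertLift 𝓘(ℝ, EM) (fiberIncl F E e.proj (y t)) (ν (fiberIncl F E e.proj (y t))))
    rw [h3]
    exact Prod.ext (smul_zero r).symm rfl

theorem vertLift_mem_vertSpace (e : TotalSpace F E) (v : E e.proj) :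
    vertLift 𝓘(ℝ, EM) e v ∈ vertSpace 𝓘(ℝ, EM) e := by
  obtain ⟨p, x⟩ := e
  obtain ⟨y, rfl⟩ := (fiberEquiv F E p).symm.surjective x
  obtain ⟨w, rfl⟩ := (fiberEquiv F E p).symm.surjective v
  rw [vertSpace, LinearMap.mem_ker]
  have hv := vertLift_fiberIncl (EM := EM) (E := E) p y w
  have hproj : MDifferentiableAt (𝓘(ℝ, EM).prod 𝓘(ℝ, F)) 𝓘(ℝ, EM)
      (TotalSpace.proj : TotalSpace F E → M) (fiberIncl F E p y) :=
    (contMDiff_proj (n := 1) E _).mdifferentiableAt one_ne_zero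
  have h := hproj.hasMFDerivAt.comp y (hasMFDerivAt_fiberIncl (EM := EM) (E := E) p y)
  have h' : HasMFDerivAt 𝓘(ℝ, F) 𝓘(ℝ, EM) (fun _ : F => p) y
      (0 : F →L[ℝ] EM) := hasMFDerivAt_const _ _
  have h2 := hasMFDerivAt_unique h h'
  have h3 := congrArg (fun A : F →L[ℝ] EM => A w) h2
  refine Eq.trans ?_ h3
  exact congrArg (fun u : EM × F => (mfderiv (𝓘(ℝ, EM).prod 𝓘(ℝ, F)) 𝓘(ℝ, EM)
    (TotalSpace.proj : TotalSpace F E → M) (fiberIncl F E p y)) u) hv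

variable {ι : Type*} [Fintype ι] {ν μ : ι → ∀ e : TotalSpace F E, E e.proj}

theorem dirDeriv_vertLift (ν : ∀ e : TotalSpace F E, E e.proj) {f : TotalSpace F E → ℝ}
    (hf : ContMDiff (𝓘(ℝ, EM).prod 𝓘(ℝ, F)) 𝓘(ℝ, ℝ) ∞ f) (p : M) (y : F) :
    dirDeriv (𝓘(ℝ, EM).prod 𝓘(ℝ, F)) (fun e => vertLift 𝓘(ℝ, EM) e (ν e)) f (fiberIncl F E p y) =
      fderiv ℝ (fun z => f (fiberIncl F E p z)) y (fiberField ν p y) := by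
  have h := mfderiv_vertLift (EM := EM) (f := f) (e := fiberIncl F E p y)
    ((hf _).mdifferentiableAt (by simp)) (ν (fiberIncl F E p y))
  refine h.trans ?_
  have h1 : fiberEquiv F E (fiberIncl F E p y).proj (fiberIncl F E p y).2 = y :=
    ContinuousLinearEquiv.apply_symm_apply _ _
  rw [h1]
  rfl

theorem poissonBracket_vertLift (ν μ : ι → ∀ e : TotalSpace F E, E e.proj)
    {f g : TotalSpace F E → ℝ}
    (hf : ContMDiff (𝓘(ℝ, EM).prod 𝓘(ℝ, F)) 𝓘(ℝ, ℝ) ∞ f)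
    (hg : ContMDiff (𝓘(ℝ, EM).prod 𝓘(ℝ, F)) 𝓘(ℝ, ℝ) ∞ g) (p : M) (y : F) :
    poissonBracket (𝓘(ℝ, EM).prod 𝓘(ℝ, F))
      (fun e => ∑ i, wedge (vertLift 𝓘(ℝ, EM) e (ν i e)) (vertLift 𝓘(ℝ, EM) e (μ i e))) f g
      (fiberIncl F E p y) =
    fieldBracket (fun i => fiberField (ν i) p) (fun i => fiberField (μ i) p)
      (fun z => f (fiberIncl F E p z)) (fun z => g (fiberIncl F E p z)) y := by
  rw [poissonBracket_sum_wedge (𝓘(ℝ, EM).prod 𝓘(ℝ, F)) (fun i e => vertLift 𝓘(ℝ, EM) e (ν i e))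
    (fun i e => vertLift 𝓘(ℝ, EM) e (μ i e))]
  simp only [dirDeriv_vertLift _ hf, dirDeriv_vertLift _ hg]
  rfl

/-- A vertical bivector differentiates along fibres only, so its bracket restricts to a bracket on
each fibre, where the Jacobi identity follows from commutation. -/
theorem isPoissonStructure_sum_wedge_vertLift [FiniteDimensional ℝ EM] [FiniteDimensional ℝ F]
    [IsManifold 𝓘(ℝ, EM) ∞ M] [ContMDiffVectorBundle ∞ F E 𝓘(ℝ, EM)]
    (hν : ∀ i, ContMDiff (𝓘(ℝ, EM).prod 𝓘(ℝ, F)) (𝓘(ℝ, EM).prod 𝓘(ℝ, F)) ∞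
      fun e => (⟨e.proj, ν i e⟩ : TotalSpace F E))
    (hμ : ∀ i, ContMDiff (𝓘(ℝ, EM).prod 𝓘(ℝ, F)) (𝓘(ℝ, EM).prod 𝓘(ℝ, F)) ∞
      fun e => (⟨e.proj, μ i e⟩ : TotalSpace F E))
    (hνν : ∀ i j p y, fderiv ℝ (fiberField (ν j) p) y (fiberField (ν i) p y) =
      fderiv ℝ (fiberField (ν i) p) y (fiberField (ν j) p y))
    (hνμ : ∀ i j p y, fderiv ℝ (fiberField (μ j) p) y (fiberField (ν i) p y) =
      fderiv ℝ (fiberField (ν i) p) y (fiberField (μ j) p y))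
    (hμμ : ∀ i j p y, fderiv ℝ (fiberField (μ j) p) y (fiberField (μ i) p y) =
      fderiv ℝ (fiberField (μ i) p) y (fiberField (μ j) p y)) :
    IsPoissonStructure (𝓘(ℝ, EM).prod 𝓘(ℝ, F))
      (fun e : TotalSpace F E =>
        ∑ i, wedge (vertLift 𝓘(ℝ, EM) e (ν i e)) (vertLift 𝓘(ℝ, EM) e (μ i e))) := by
  have sν := fun i => isSmoothVectorField_vertLift (hν i)
  have sμ := fun i => isSmoothVectorField_vertLift (hμ i)
  refine ⟨isSmoothBivectorSection_sum_wedge (𝓘(ℝ, EM).prod 𝓘(ℝ, F)) sν sμ, ?_⟩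
  -- The restriction formula applies to smooth functions, so the inner bracket must be smooth before
  -- the outer one can be restricted.
  have hsm : ∀ {f g : TotalSpace F E → ℝ}, ContMDiff (𝓘(ℝ, EM).prod 𝓘(ℝ, F)) 𝓘(ℝ, ℝ) ∞ f →
      ContMDiff (𝓘(ℝ, EM).prod 𝓘(ℝ, F)) 𝓘(ℝ, ℝ) ∞ g →
      ContMDiff (𝓘(ℝ, EM).prod 𝓘(ℝ, F)) 𝓘(ℝ, ℝ) ∞ (poissonBracket (𝓘(ℝ, EM).prod 𝓘(ℝ, F))
        (fun e : TotalSpace F E =>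
          ∑ i, wedge (vertLift 𝓘(ℝ, EM) e (ν i e)) (vertLift 𝓘(ℝ, EM) e (μ i e))) f g) := by
    intro f g hf hg
    have heq := funext (poissonBracket_sum_wedge (𝓘(ℝ, EM).prod 𝓘(ℝ, F))
      (fun i (e : TotalSpace F E) => vertLift 𝓘(ℝ, EM) e (ν i e))
      (fun i e => vertLift 𝓘(ℝ, EM) e (μ i e)) f g)
    rw [heq]
    exact contMDiff_finsetSum fun i _ =>
      ((contMDiff_dirDeriv _ (sν i) hf).mul (contMDiff_dirDeriv _ (sμ i) hg)).sub
        ((contMDiff_dirDeriv _ (sμ i) hf).mul (contMDiff_dirDeriv _ (sν i) hg))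
  intro f g h hf hg hh e
  rw [← fiberIncl_fiberEquiv e]
  generalize fiberEquiv F E e.proj e.2 = y
  generalize e.proj = p
  have hfib : ∀ {f : TotalSpace F E → ℝ}, ContMDiff (𝓘(ℝ, EM).prod 𝓘(ℝ, F)) 𝓘(ℝ, ℝ) ∞ f →
      ContDiff ℝ ∞ fun z => f (fiberIncl F E p z) := fun hf =>
    contMDiff_iff_contDiff.1 (hf.comp (contMDiff_fiberIncl p))
  rw [poissonBracket_vertLift ν μ hf (hsm hg hh), poissonBracket_vertLift ν μ hg (hsm hh hf),
    poissonBracket_vertLift ν μ hh (hsm hf hg)]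
  simp only [poissonBracket_vertLift ν μ hg hh, poissonBracket_vertLift ν μ hh hf,
    poissonBracket_vertLift ν μ hf hg]
  exact fieldBracket_jacobi
    (fun i => (contDiff_fiberField (hν i) p).differentiable (by simp))
    (fun i => (contDiff_fiberField (hμ i) p).differentiable (by simp)) (hfib hf) (hfib hg)
    (hfib hh) y (fun i j => hνν i j p y) (fun i j => hνμ i j p y) (fun i j => hμμ i j p y)

end Fiber

/-! ### Finitely many generating sections by general position. -/

section Sections

variable {EM : Type*} [NormedAddCommGroup EM] [NormedSpace ℝ EM] [FiniteDimensional ℝ EM]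
  {M : Type*} [TopologicalSpace M] [ChartedSpace EM M] [IsManifold 𝓘(ℝ, EM) ∞ M]
  {F : Type*} [NormedAddCommGroup F] [NormedSpace ℝ F] [FiniteDimensional ℝ F]
  (E : M → Type*) [TopologicalSpace (TotalSpace F E)]
  [∀ p, AddCommGroup (E p)] [∀ p, Module ℝ (E p)] [∀ p, TopologicalSpace (E p)]
  [FiberBundle F E] [VectorBundle ℝ F E] [ContMDiffVectorBundle ∞ F E 𝓘(ℝ, EM)]

variable (EM F)

/-- Local frames multiplied by a partition of unity subordinate to a countable cover. Each section
is nonzero only inside one trivialising chart, where the dimension count can be made. -/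
theorem exists_locallyFinite_frame_sections [T2Space M] [SecondCountableTopology M] [Nonempty M] :
    ∃ s : ℕ → ∀ p, E p,
      (∀ j, ContMDiff 𝓘(ℝ, EM) (𝓘(ℝ, EM).prod 𝓘(ℝ, F)) ∞ fun p => TotalSpace.mk' F p (s j p)) ∧
      LocallyFinite (fun j => {p | s j p ≠ 0}) ∧
      (∀ j, ∃ x₀ : M, ∀ p, s j p ≠ 0 →
        p ∈ (chartAt EM x₀).source ∩ (trivializationAt F E x₀).baseSet) ∧
      ∀ p (φ : Module.Dual ℝ (E p)), (∀ j, φ (s j p) = 0) → φ = 0 := by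
  classical
  have : LocallyCompactSpace M := Manifold.locallyCompact_of_finiteDimensional 𝓘(ℝ, EM)
  let U : M → Set M := fun x => (chartAt EM x).source ∩ (trivializationAt F E x).baseSet
  have hUo : ∀ x, IsOpen (U x) := fun x =>
    (chartAt EM x).open_source.inter (trivializationAt F E x).open_baseSet
  obtain ⟨t, ht, htU⟩ := TopologicalSpace.countable_cover_nhds (f := U) fun x =>
    (hUo x).mem_nhds ⟨mem_chart_source EM x, FiberBundle.mem_baseSet_trivializationAt' x⟩
  obtain ⟨ρ, hρ⟩ := SmoothPartitionOfUnity.exists_isSubordinate 𝓘(ℝ, EM) (isClosed_univ (X := M))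
    (fun x : t => U x) (fun x => hUo x) (by rw [← htU, biUnion_eq_iUnion])
  have : Countable t := ht
  let b := Module.finBasis ℝ F
  let _ : Encodable (t × Fin (Module.finrank ℝ F)) := Encodable.ofCountable _
  let s' : t × Fin (Module.finrank ℝ F) → ∀ p, E p := fun i p =>
    ρ i.1 p • (trivializationAt F E (i.1 : M)).symm p (b i.2)
  have hs' : ∀ i, ContMDiff 𝓘(ℝ, EM) (𝓘(ℝ, EM).prod 𝓘(ℝ, F)) ∞
      fun p => TotalSpace.mk' F p (s' i p) := by
    intro i
    refine ContMDiffOn.smul_section_of_tsupport (u := (trivializationAt F E (i.1 : M)).baseSet)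
      (ρ i.1).contMDiff.contMDiffOn (Trivialization.open_baseSet _)
      ((hρ i.1).trans inter_subset_right) ?_
    rw [Trivialization.contMDiffOn_section_baseSet_iff]
    refine (contMDiffOn_const (c := b i.2)).congr fun p hp => ?_
    rw [Trivialization.apply_mk_symm _ hp]
  have hs0 : ∀ i p, s' i p ≠ 0 → p ∈ Function.support (ρ i.1) := fun i p h h0 =>
    h (by simp only [s']; rw [h0, zero_smul])
  have hinj : Function.Injective (Encodable.encode : t × Fin (Module.finrank ℝ F) → ℕ) :=
    Encodable.encode_injective
  -- Indices outside the range of the encoding carry the zero section, so the family is indexed by ℕ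
  -- and permits recursion.
  let s : ℕ → ∀ p, E p := Function.extend Encodable.encode s' fun _ _ => 0
  have hs : ∀ i, s (Encodable.encode i) = s' i := fun i => hinj.extend_apply s' _ i
  have hsc : ∀ n, (s n = fun _ => 0) ∨ ∃ i, Encodable.encode i = n ∧ s n = s' i := fun n => by
    by_cases h : ∃ i : t × Fin (Module.finrank ℝ F), Encodable.encode i = n
    · obtain ⟨i, rfl⟩ := h
      exact Or.inr ⟨i, rfl, hs i⟩
    · exact Or.inl (Function.extend_apply' s' _ n h)
  refine ⟨s, fun n => ?_, ?_, fun n => ?_, fun p φ h => ?_⟩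
  · rcases hsc n with h | ⟨i, -, h⟩
    · rw [h]; exact contMDiff_zeroSection ℝ E
    · rw [h]; exact hs' i
  · intro p
    obtain ⟨V, hV, hfin⟩ := ρ.locallyFinite p
    refine ⟨V, hV, ((hfin.prod (finite_univ (α := Fin (Module.finrank ℝ F)))).image Encodable.encode).subset ?_⟩
    rintro n ⟨q, hq, hqV⟩
    rcases hsc n with h | ⟨i, rfl, h⟩
    · exact absurd (congrFun h q) hq
    · refine ⟨i, ⟨⟨q, hs0 i q ?_, hqV⟩, mem_univ _⟩, rfl⟩
      rw [← h]; exact hq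
  · rcases hsc n with h | ⟨i, rfl, h⟩
    · exact ⟨Classical.arbitrary M, fun p hp => absurd (congrFun h p) hp⟩
    · exact ⟨i.1, fun p hp => hρ i.1 (subset_closure (hs0 i p (by rwa [h] at hp)))⟩
  · obtain ⟨x, hx⟩ := ρ.exists_pos_of_mem (mem_univ p)
    have hp : p ∈ (trivializationAt F E (x : M)).baseSet :=
      (hρ x (subset_closure hx.ne')).2
    let L := (trivializationAt F E (x : M)).continuousLinearEquivAt ℝ p hp
    have h1 : φ ∘ₗ L.symm.toLinearEquiv.toLinearMap = 0 := by
      refine b.ext fun k => ?_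
      have h2 := h (Encodable.encode (x, k))
      rw [hs] at h2
      simp only [s', map_smul, smul_eq_mul, mul_eq_zero, hx.ne', false_or] at h2
      exact h2
    ext v
    have := LinearMap.congr_fun h1 (L v)
    simpa using this

variable {EM F E}

/-- A bad v equals -φ(sⱼ)⁻¹ ∑_{i<j} φ(sᵢ) aᵢ for some (p, φ). These form the image of an open set of
dimension dim M + rank E under a smooth map into ℝᵈ, so some v is missed. -/
theorem exists_avoiding_coefficient {d : ℕ} (hd : Module.finrank ℝ EM + Module.finrank ℝ F < d)
    {s : ℕ → ∀ p, E p}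
    (hs : ∀ j, ContMDiff 𝓘(ℝ, EM) (𝓘(ℝ, EM).prod 𝓘(ℝ, F)) ∞ fun p => TotalSpace.mk' F p (s j p))
    {j : ℕ} {x₀ : M} (hx : ∀ p, s j p ≠ 0 →
        p ∈ (chartAt EM x₀).source ∩ (trivializationAt F E x₀).baseSet)
    (a : ℕ → Fin d → ℝ) :
    ∃ v : Fin d → ℝ, ∀ p (φ : Module.Dual ℝ (E p)), φ (s j p) ≠ 0 →
      ∑ i ∈ Finset.range j, φ (s i p) • a i + φ (s j p) • v ≠ 0 := by
  let T := trivializationAt F E x₀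
  let c := extChartAt 𝓘(ℝ, EM) x₀
  let O : Set EM := c.target ∩ c.symm ⁻¹' T.baseSet
  have hO : IsOpen O :=
    (continuousOn_extChartAt_symm x₀).isOpen_inter_preimage (isOpen_extChartAt_target x₀)
      T.open_baseSet
  let σ : ℕ → EM → F := fun i u => (T ⟨c.symm u, s i (c.symm u)⟩).2
  have hσ : ∀ i, ContDiffOn ℝ ∞ (σ i) O := by
    intro i
    rw [← contMDiffOn_iff_contDiffOn]
    have h1 : ContMDiffOn 𝓘(ℝ, EM) 𝓘(ℝ, F) ∞ (fun p => (T ⟨p, s i p⟩).2) T.baseSet :=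
      (T.contMDiffOn_section_baseSet_iff).1 (hs i).contMDiffOn
    exact h1.comp ((contMDiffOn_extChartAt_symm x₀).mono inter_subset_left) inter_subset_right
  let ψσ : ℕ → EM × (F →L[ℝ] ℝ) → ℝ := fun i z => z.2 (σ i z.1)
  have hψσ : ∀ i, ContDiffOn ℝ ∞ (ψσ i) (O ×ˢ univ) := fun i =>
    contDiffOn_snd.clm_apply ((hσ i).comp contDiffOn_fst fun z hz => hz.1)
  let D : Set (EM × (F →L[ℝ] ℝ)) := (O ×ˢ univ) ∩ ψσ j ⁻¹' {0}ᶜ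
  have hD : IsOpen D := (hψσ j).continuousOn.isOpen_inter_preimage (hO.prod isOpen_univ)
    isOpen_compl_singleton
  let f : EM × (F →L[ℝ] ℝ) → Fin d → ℝ := fun z =>
    -((ψσ j z)⁻¹ • ∑ i ∈ Finset.range j, ψσ i z • a i)
  have hf : ContDiffOn ℝ ∞ f D := by
    refine (ContDiffOn.smul (((hψσ j).mono inter_subset_left).inv fun z hz => hz.2) ?_).neg
    exact ContDiffOn.sum fun i _ => ((hψσ i).mono inter_subset_left).smul contDiffOn_const
  have hfin : Module.finrank ℝ (EM × (F →L[ℝ] ℝ)) < Module.finrank ℝ (Fin d → ℝ) := by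
    have h1 : Module.finrank ℝ (F →L[ℝ] ℝ) = Module.finrank ℝ F := by
      rw [← (LinearMap.toContinuousLinearMap (𝕜 := ℝ) (E := F) (F' := ℝ)).finrank_eq]
      exact Subspace.dual_finrank_eq
    rw [Module.finrank_prod, h1]
    simpa using hd
  obtain ⟨v, hv⟩ := exists_notMem_image_of_contDiffOn hD (hf.of_le (by simp)) hfin
  refine ⟨v, fun p φ hφ h0 => hv ?_⟩
  have hp := hx p fun h => hφ (by rw [h, map_zero])
  have hpc : p ∈ c.source := by rw [extChartAt_source]; exact hp.1
  let L := T.continuousLinearEquivAt ℝ p hp.2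
  let ψ : F →L[ℝ] ℝ := LinearMap.toContinuousLinearMap (φ ∘ₗ L.symm.toLinearEquiv.toLinearMap)
  have hu : c.symm (c p) = p := c.left_inv hpc
  have key : ∀ i, ψσ i (c p, ψ) = φ (s i p) := by
    intro i
    have h1 : σ i (c p) = L (s i p) := by
      simp only [σ]
      rw [hu]
      rfl
    change ψ (σ i (c p)) = _
    rw [h1]
    simp [ψ]
  refine ⟨(c p, ψ), ⟨⟨⟨c.map_source hpc, ?_⟩, mem_univ _⟩, ?_⟩, ?_⟩
  · change c.symm (c p) ∈ T.baseSet
    rw [hu]; exact hp.2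
  · change ψσ j (c p, ψ) ≠ 0
    rwa [key]
  · simp only [f, key]
    rw [eq_neg_of_add_eq_zero_left h0, smul_neg, neg_neg, inv_smul_smul₀ hφ]

variable (EM F E)

/-- A vector bundle of rank `r` over an `n`-dimensional manifold is generated by any number
`d > n + r` of global sections in general position. -/
theorem exists_generating_sections [T2Space M] [SecondCountableTopology M] {d : ℕ}
    (hd : Module.finrank ℝ EM + Module.finrank ℝ F < d) :
    ∃ S : Fin d → ∀ p, E p,
      (∀ k, ContMDiff 𝓘(ℝ, EM) (𝓘(ℝ, EM).prod 𝓘(ℝ, F)) ∞ fun p => TotalSpace.mk' F p (S k p)) ∧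
      ∀ p, Submodule.span ℝ (range fun k => S k p) = ⊤ := by
  rcases isEmpty_or_nonempty M with hM | hM
  · exact ⟨0, fun _ p => isEmptyElim p, fun p => isEmptyElim p⟩
  obtain ⟨s, hs, hlf, hx, hspan⟩ := exists_locallyFinite_frame_sections EM F E
  choose x₀ hx using hx
  choose v hv using fun j a => exists_avoiding_coefficient hd hs (hx j) a
  -- Each aⱼ avoids the bad set determined by its predecessors; the value 0 for i ≥ j is never read.
  let a : ℕ → Fin d → ℝ := fun n => Nat.strongRecOn n fun j ih =>
    v j fun i => if h : i < j then ih i h else 0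
  have ha : ∀ j, a j = v j fun i => if i < j then a i else 0 := fun j => by
    simp only [a]
    rw [Nat.strongRecOn_eq]
    simp only [dite_eq_ite]
  have hav : ∀ j p (φ : Module.Dual ℝ (E p)), φ (s j p) ≠ 0 →
      ∑ i ∈ Finset.range (j + 1), φ (s i p) • a i ≠ 0 := by
    intro j p φ hφ
    rw [Finset.sum_range_succ, ha j]
    convert hv j (fun i => if i < j then a i else 0) p φ hφ using 2
    refine Finset.sum_congr rfl fun i hi => ?_
    rw [if_pos (Finset.mem_range.1 hi)]
  refine ⟨fun k p => ∑ᶠ j, a j k • s j p, fun k => ?_, fun p => ?_⟩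
  · refine ContMDiff.finsum_section_of_locallyFinite (hlf.subset fun j p hp h => ?_) fun j => ?_
    · exact hp (by rw [h, smul_zero])
    · exact (contMDiff_const (c := a j k)).smul_section (hs j)
  · by_contra hne
    obtain ⟨φ, hφ0, hφ⟩ := Submodule.exists_le_ker_of_lt_top _ (lt_top_iff_ne_top.2 hne)
    have hfin : {j | s j p ≠ 0}.Finite := hlf.point_finite p
    obtain ⟨N, hN⟩ := hfin.bddAbove
    have hN' : ∀ j, s j p ≠ 0 → j < N + 1 := fun j hj => Nat.lt_succ_of_le (hN hj)
    have hsum : ∑ j ∈ Finset.range (N + 1), φ (s j p) • a j = 0 := by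
      funext k
      have h1 : φ (∑ᶠ j, a j k • s j p) = 0 := hφ (Submodule.subset_span ⟨k, rfl⟩)
      have h2 : (Function.support fun j => a j k • s j p) ⊆ ↑(Finset.range (N + 1)) :=
        fun j hj => by
          simp only [Finset.coe_range, mem_Iio]
          exact hN' j fun h => hj (by simp [h])
      rw [finsum_eq_sum_of_support_subset _ h2] at h1
      simpa [mul_comm] using h1
    obtain ⟨j, hj⟩ : ∃ j, φ (s j p) ≠ 0 := by
      by_contra! h
      exact hφ0 (hspan p φ h)
    have hfinφ : {j | φ (s j p) ≠ 0}.Finite := hfin.subset fun j hj h => hj (by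
      rw [h, map_zero])
    -- A functional φ killing every Sₖ gives ∑ φ(sⱼ) aⱼ = 0. Cutting this sum at the last nonzero
    -- coefficient contradicts the choice of `a m`.
    obtain ⟨m, hm, hmax⟩ := hfinφ.exists_maximalFor id _ ⟨j, hj⟩
    refine hav m p φ hm (Eq.trans ?_ hsum)
    refine Finset.sum_subset ?_ fun i _ hi => ?_
    · intro i hi
      have := hN' m fun h => hm (by rw [h, map_zero])
      simp only [Finset.mem_range] at hi ⊢
      omega
    · by_cases h0 : φ (s i p) = 0
      · rw [h0, zero_smul]
      · exfalso
        rcases le_total i m with h | h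
        · exact hi (Finset.mem_range.2 (by omega))
        · exact hi (Finset.mem_range.2 (Nat.lt_succ_of_le (hmax h0 h)))

end Sections

/-! ### Writing γ as ∑ Sₖ ∧ Tₖ with smooth Tₖ. -/

section Decomposition

variable {EM : Type*} [NormedAddCommGroup EM] [NormedSpace ℝ EM]
  {M : Type*} [TopologicalSpace M] [ChartedSpace EM M]
  {F : Type*} [NormedAddCommGroup F] [NormedSpace ℝ F] [FiniteDimensional ℝ F]
  {E : M → Type*} [TopologicalSpace (TotalSpace F E)]
  [∀ p, AddCommGroup (E p)] [∀ p, Module ℝ (E p)] [∀ p, TopologicalSpace (E p)]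
  [FiberBundle F E] [VectorBundle ℝ F E]

theorem contMDiffOn_linear_bivector {γ : ∀ p, ⋀[ℝ]^2 (E p)}
    (hγ : IsSmoothBivectorSection 𝓘(ℝ, EM) F E γ) (x₀ : M) (G : ⋀[ℝ]^2 F →ₗ[ℝ] F) :
    ContMDiffOn 𝓘(ℝ, EM) 𝓘(ℝ, F) ∞ (fun p => G (exteriorPower.map 2
      ((trivializationAt F E x₀).linearMapAt ℝ p) (γ p))) (trivializationAt F E x₀).baseSet := by
  let b := Module.finBasis ℝ F
  have h : ContMDiffOn 𝓘(ℝ, EM) 𝓘(ℝ, F) ∞ (fun p => ∑ k, (b.coord k ∘ₗ G) (exteriorPower.map 2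
      ((trivializationAt F E x₀).linearMapAt ℝ p) (γ p)) • b k)
      (trivializationAt F E x₀).baseSet :=
    contMDiffOn_finsetSum fun k _ => (hγ x₀ (b.coord k ∘ₗ G)).smul contMDiffOn_const
  refine h.congr fun p _ => ?_
  exact (b.sum_repr _).symm

variable [ContMDiffVectorBundle ∞ F E 𝓘(ℝ, EM)]

theorem exists_local_wedge_decomposition {d : ℕ} {S : Fin d → ∀ p, E p}
    (hS : ∀ k, ContMDiff 𝓘(ℝ, EM) (𝓘(ℝ, EM).prod 𝓘(ℝ, F)) ∞ fun p => TotalSpace.mk' F p (S k p))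
    (hspan : ∀ p, Submodule.span ℝ (range fun k => S k p) = ⊤) {γ : ∀ p, ⋀[ℝ]^2 (E p)}
    (hγ : IsSmoothBivectorSection 𝓘(ℝ, EM) F E γ) (x₀ : M) :
    ∃ V : Set M, IsOpen V ∧ x₀ ∈ V ∧ ∃ T : Fin d → ∀ p, E p,
      (∀ k, ContMDiffOn 𝓘(ℝ, EM) (𝓘(ℝ, EM).prod 𝓘(ℝ, F)) ∞
        (fun p => TotalSpace.mk' F p (T k p)) V) ∧
      ∀ p ∈ V, ∑ k, wedge (S k p) (T k p) = γ p := by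
  have : CompleteSpace F := FiniteDimensional.complete ℝ F
  let e := trivializationAt F E x₀
  let b := Module.finBasis ℝ F
  obtain ⟨G, hG⟩ := exists_linear_wedge_decomposition b
  let A : M → (Fin d → ℝ) →L[ℝ] F := fun p =>
    ∑ k, (ContinuousLinearMap.proj (R := ℝ) (φ := fun _ : Fin d => ℝ) k).smulRight (e ⟨p, S k p⟩).2
  have hA : ∀ p c, A p c = ∑ k, c k • (e ⟨p, S k p⟩).2 := fun p c => by simp [A]
  have hSe : ∀ k, ContMDiffOn 𝓘(ℝ, EM) 𝓘(ℝ, F) ∞ (fun p => (e ⟨p, S k p⟩).2) e.baseSet :=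
    fun k => (e.contMDiffOn_section_baseSet_iff).1 (hS k).contMDiffOn
  have hAs : ContMDiffOn 𝓘(ℝ, EM) 𝓘(ℝ, (Fin d → ℝ) →L[ℝ] F) ∞ A e.baseSet :=
    contMDiffOn_finsetSum fun k _ =>
      ((ContinuousLinearMap.smulRightL ℝ (Fin d → ℝ) F
        (ContinuousLinearMap.proj k)).contDiff.contMDiff.comp_contMDiffOn (hSe k))
  have hx₀ : x₀ ∈ e.baseSet := FiberBundle.mem_baseSet_trivializationAt' x₀
  have hsurj : LinearMap.range (A x₀).toLinearMap = ⊤ := by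
    let L := e.continuousLinearEquivAt ℝ x₀ hx₀
    have h1 : Submodule.map L.toLinearEquiv.toLinearMap
        (Submodule.span ℝ (range fun k => S k x₀)) = ⊤ := by
      rw [hspan, Submodule.map_top]; exact LinearEquiv.range _
    rw [eq_top_iff, ← h1, Submodule.map_span, Submodule.span_le]
    rintro _ ⟨_, ⟨k, rfl⟩, rfl⟩
    refine ⟨Pi.single k 1, ?_⟩
    change A x₀ (Pi.single k 1) = (e ⟨x₀, S k x₀⟩).2
    rw [hA, Finset.sum_eq_single k (fun i _ hi => by simp [Pi.single_eq_of_ne hi]) (by simp)]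
    simp
  obtain ⟨B, hB⟩ := (A x₀).toLinearMap.exists_rightInverse_of_surjective hsurj
  let B' : F →L[ℝ] (Fin d → ℝ) := LinearMap.toContinuousLinearMap B
  -- The right inverse of `A x₀` is kept fixed and corrected: `N` is the identity at `x₀`, hence
  -- invertible nearby, and `B' ∘ N⁻¹` is a smooth right inverse of `A`.
  let N : M → F →L[ℝ] F := fun p => (A p).comp B'
  have hN : ContMDiffOn 𝓘(ℝ, EM) 𝓘(ℝ, F →L[ℝ] F) ∞ N e.baseSet := hAs.clm_comp contMDiffOn_const
  have hN0 : N x₀ = 1 := ContinuousLinearMap.ext fun v => LinearMap.congr_fun hB v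
  let V : Set M := e.baseSet ∩ N ⁻¹' {u | IsUnit u}
  have hVo : IsOpen V := hN.continuousOn.isOpen_inter_preimage e.open_baseSet Units.isOpen
  let C : M → F →L[ℝ] (Fin d → ℝ) := fun p => B'.comp (Ring.inverse (N p))
  have hC : ContMDiffOn 𝓘(ℝ, EM) 𝓘(ℝ, F →L[ℝ] (Fin d → ℝ)) ∞ C V := by
    refine contMDiffOn_const.clm_comp fun p hp => ?_
    obtain ⟨u, hu⟩ := hp.2
    have h1 : ContMDiffAt 𝓘(ℝ, F →L[ℝ] F) 𝓘(ℝ, F →L[ℝ] F) ∞ Ring.inverse (N p) := by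
      rw [← hu]; exact (contDiffAt_ringInverse ℝ u).contMDiffAt
    exact h1.comp_contMDiffWithinAt p ((hN p hp.1).mono inter_subset_left)
  have hAC : ∀ p ∈ V, ∀ v, A p (C p v) = v := fun p hp v => by
    have h1 : N p * Ring.inverse (N p) = 1 := Ring.mul_inverse_cancel _ hp.2
    exact congrArg (fun u : F →L[ℝ] F => u v) h1
  let w : ∀ p, ⋀[ℝ]^2 F := fun p => exteriorPower.map 2 (e.linearMapAt ℝ p) (γ p)
  -- Obtained by substituting bᵢ = ∑ₖ C(bᵢ)ₖ Sₖ into w = ∑ᵢ bᵢ ∧ Gᵢ(w) and collecting the factors of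
  -- Sₖ.
  let t : Fin d → M → F := fun k p => ∑ i, C p (b i) k • G i (w p)
  have ht : ∀ k, ContMDiffOn 𝓘(ℝ, EM) 𝓘(ℝ, F) ∞ (t k) V := fun k => by
    refine contMDiffOn_finsetSum fun i _ => ?_
    have h1 : ContMDiffOn 𝓘(ℝ, EM) 𝓘(ℝ, ℝ) ∞ (fun p => C p (b i) k) V :=
      (ContinuousLinearMap.proj (R := ℝ) (φ := fun _ : Fin d => ℝ)
        k).contDiff.contMDiff.comp_contMDiffOn (hC.clm_apply contMDiffOn_const)
    exact h1.smul ((contMDiffOn_linear_bivector hγ x₀ (G i)).mono inter_subset_left)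
  refine ⟨V, hVo, ⟨hx₀, by simp [hN0]⟩, fun k p => e.symm p (t k p), fun k => ?_, fun p hp => ?_⟩
  · rw [e.contMDiffOn_section_iff hVo inter_subset_left]
    refine (ht k).congr fun p hp => ?_
    rw [Trivialization.apply_mk_symm _ hp.1]
  · let L := (e.continuousLinearEquivAt ℝ p hp.1).toLinearEquiv
    have hL : e.linearMapAt ℝ p = L.toLinearMap := by
      ext v
      rw [e.coe_linearMapAt_of_mem hp.1]
      rfl
    have h1 : w p = ∑ k, wedge (L (S k p)) (t k p) := by
      have h2 : ∀ i, b i = ∑ k, C p (b i) k • L (S k p) := fun i => by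
        conv_lhs => rw [← hAC p hp (b i), hA]
        rfl
      calc w p = ∑ i, wedge (b i) (G i (w p)) := (hG _).symm
        _ = ∑ i, ∑ k, C p (b i) k • wedge (L (S k p)) (G i (w p)) := by
          refine Finset.sum_congr rfl fun i _ => ?_
          conv_lhs => rw [h2 i]
          simp only [← wedgeₗ_apply, map_sum, map_smul, LinearMap.sum_apply, LinearMap.smul_apply]
        _ = _ := by
          rw [Finset.sum_comm]
          refine Finset.sum_congr rfl fun k _ => ?_
          simp only [t, ← wedgeₗ_apply, map_sum, map_smul]
    have h3 : exteriorPower.map 2 L.symm.toLinearMap (w p) = γ p := by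
      simp only [w]
      rw [hL, ← LinearMap.comp_apply, ← exteriorPower.map_comp]
      simp
    rw [← h3, h1, map_sum]
    refine Finset.sum_congr rfl fun k _ => ?_
    rw [map_wedge]
    congr 1
    exact (L.symm_apply_apply _).symm

/-- With the Sₖ fixed globally, the equation is affine in the Tₖ, so local solutions can be averaged
by a partition of unity. -/
theorem exists_wedge_decomposition [FiniteDimensional ℝ EM] [IsManifold 𝓘(ℝ, EM) ∞ M]
    [T2Space M] [SecondCountableTopology M] {d : ℕ} {S : Fin d → ∀ p, E p}
    (hS : ∀ k, ContMDiff 𝓘(ℝ, EM) (𝓘(ℝ, EM).prod 𝓘(ℝ, F)) ∞ fun p => TotalSpace.mk' F p (S k p))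
    (hspan : ∀ p, Submodule.span ℝ (range fun k => S k p) = ⊤) {γ : ∀ p, ⋀[ℝ]^2 (E p)}
    (hγ : IsSmoothBivectorSection 𝓘(ℝ, EM) F E γ) :
    ∃ T : Fin d → ∀ p, E p,
      (∀ k, ContMDiff 𝓘(ℝ, EM) (𝓘(ℝ, EM).prod 𝓘(ℝ, F)) ∞ fun p => TotalSpace.mk' F p (T k p)) ∧
      ∀ p, ∑ k, wedge (S k p) (T k p) = γ p := by
  have : LocallyCompactSpace M := Manifold.locallyCompact_of_finiteDimensional 𝓘(ℝ, EM)
  choose V hVo hV T hT hTγ using exists_local_wedge_decomposition hS hspan hγ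
  obtain ⟨ρ, hρ⟩ := SmoothPartitionOfUnity.exists_isSubordinate 𝓘(ℝ, EM) (isClosed_univ (X := M))
    V hVo fun x _ => mem_iUnion_of_mem x (hV x)
  refine ⟨fun k p => ∑ᶠ x, ρ x p • T x k p, fun k => ?_, fun p => ?_⟩
  · refine ContMDiff.finsum_section_of_locallyFinite
      (ρ.locallyFinite.subset fun x p hp h => hp (by rw [h, zero_smul])) fun x => ?_
    exact ContMDiffOn.smul_section_of_tsupport (ρ x).contMDiff.contMDiffOn (hVo x) (hρ x) (hT x k)
  · have hfin : {x | ρ x p ≠ 0}.Finite := ρ.locallyFinite.point_finite p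
    have hsum : ∀ k, ∑ᶠ x, ρ x p • T x k p = ∑ x ∈ hfin.toFinset, ρ x p • T x k p := fun k =>
      finsum_eq_sum_of_support_subset _ fun x hx => by
        rw [hfin.coe_toFinset]
        exact fun h => hx (by simp [h])
    have hone : ∑ x ∈ hfin.toFinset, ρ x p = 1 := by
      rw [← ρ.sum_eq_one (mem_univ p)]
      exact (finsum_eq_sum_of_support_subset _ fun x hx => by
        rw [hfin.coe_toFinset]; exact hx).symm
    calc ∑ k, wedge (S k p) (∑ᶠ x, ρ x p • T x k p)
        = ∑ x ∈ hfin.toFinset, ρ x p • ∑ k, wedge (S k p) (T x k p) := by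
          simp only [hsum, ← wedgeₗ_apply, map_sum, map_smul, Finset.smul_sum]
          exact Finset.sum_comm
      _ = ∑ x ∈ hfin.toFinset, ρ x p • γ p := by
          refine Finset.sum_congr rfl fun x hx => ?_
          rw [hTγ x p (hρ x (subset_closure (hfin.mem_toFinset.1 hx)))]
      _ = γ p := by rw [← Finset.sum_smul, hone, one_smul]

end Decomposition

/-! ### Fibre metrics with small unit balls. -/

section Metric

theorem exists_inner_form (F : Type*) [NormedAddCommGroup F] [NormedSpace ℝ F]
    [FiniteDimensional ℝ F] :
    ∃ B : F →L[ℝ] F →L[ℝ] ℝ, (∀ y z, B y z = B z y) ∧ (∀ y, y ≠ 0 → 0 < B y y) ∧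
      ∀ N ∈ nhds (0 : F), ∃ c > 0, ∀ y, c * B y y ≤ 1 → y ∈ N := by
  let A := toEuclidean (E := F)
  let B : F →L[ℝ] F →L[ℝ] ℝ := (innerSL ℝ).bilinearComp A.toContinuousLinearMap
    A.toContinuousLinearMap
  have hB : ∀ y z, B y z = inner ℝ (A y) (A z) := fun y z => rfl
  refine ⟨B, fun y z => ?_, fun y hy => ?_, fun N hN => ?_⟩
  · rw [hB, hB, real_inner_comm]
  · rw [hB, real_inner_self_eq_norm_sq]
    have : A y ≠ 0 := fun h => hy (A.injective (by rw [h, map_zero]))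
    positivity
  · have h1 : A.symm ⁻¹' N ∈ nhds 0 := by
      refine A.symm.continuous.continuousAt ?_
      rwa [map_zero]
    obtain ⟨ε, hε, h⟩ := Metric.mem_nhds_iff.1 h1
    -- The factor 4 yields ‖A y‖ ≤ ε/2, hence membership in the open ball.
    refine ⟨4 / ε ^ 2, by positivity, fun y hy => ?_⟩
    have h2 : A y ∈ Metric.ball 0 ε := by
      rw [mem_ball_zero_iff]
      rw [hB, real_inner_self_eq_norm_sq, div_mul_eq_mul_div, div_le_one (by positivity)] at hy
      nlinarith [norm_nonneg (A y)]
    simpa using h h2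

variable {EM : Type*} [NormedAddCommGroup EM] [NormedSpace ℝ EM] [FiniteDimensional ℝ EM]
  {M : Type*} [TopologicalSpace M] [ChartedSpace EM M] [IsManifold 𝓘(ℝ, EM) ∞ M]
  {F : Type*} [NormedAddCommGroup F] [NormedSpace ℝ F] [FiniteDimensional ℝ F]
  {E : M → Type*} [TopologicalSpace (TotalSpace F E)]
  [∀ p, AddCommGroup (E p)] [∀ p, Module ℝ (E p)] [∀ p, TopologicalSpace (E p)]
  [FiberBundle F E] [VectorBundle ℝ F E] [ContMDiffVectorBundle ∞ F E 𝓘(ℝ, EM)]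

/-- A smooth fibre metric whose closed unit balls lie in a given neighbourhood of the zero
section. -/
theorem exists_fiber_metric [T2Space M] [SecondCountableTopology M] {U : Set (TotalSpace F E)}
    (hU : IsOpen U) (h0 : ∀ p, zeroSection F E p ∈ U) :
    ∃ G : ∀ p, E p →ₗ[ℝ] E p →ₗ[ℝ] ℝ, (∀ p v w, G p v w = G p w v) ∧
      (∀ p v, v ≠ 0 → 0 < G p v v) ∧ (∀ p v, G p v v ≤ 1 → (⟨p, v⟩ : TotalSpace F E) ∈ U) ∧
      ∀ ν : ∀ e : TotalSpace F E, E e.proj,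
        ContMDiff (𝓘(ℝ, EM).prod 𝓘(ℝ, F)) (𝓘(ℝ, EM).prod 𝓘(ℝ, F)) ∞
          (fun e => (⟨e.proj, ν e⟩ : TotalSpace F E)) →
        ContMDiff (𝓘(ℝ, EM).prod 𝓘(ℝ, F)) 𝓘(ℝ, ℝ) ∞ fun e => G e.proj e.2 (ν e) := by
  have : LocallyCompactSpace M := Manifold.locallyCompact_of_finiteDimensional 𝓘(ℝ, EM)
  obtain ⟨B, hBs, hBp, hBN⟩ := exists_inner_form F
  have hloc : ∀ x : M, ∃ V : Set M, IsOpen V ∧ x ∈ V ∧ V ⊆ (trivializationAt F E x).baseSet ∧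
      ∃ c : ℝ, 0 < c ∧ ∀ p ∈ V, ∀ v : E p,
        c * B ((trivializationAt F E x).linearMapAt ℝ p v)
          ((trivializationAt F E x).linearMapAt ℝ p v) ≤ 1 → (⟨p, v⟩ : TotalSpace F E) ∈ U := by
    intro x
    let T := trivializationAt F E x
    have hx : x ∈ T.baseSet := FiberBundle.mem_baseSet_trivializationAt' x
    have hO : IsOpen (T.target ∩ T.toOpenPartialHomeomorph.symm ⁻¹' U) :=
      T.toOpenPartialHomeomorph.symm.isOpen_inter_preimage hU
    have hmem : (x, (0 : F)) ∈ T.target ∩ T.toOpenPartialHomeomorph.symm ⁻¹' U := by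
      have h1 : T (zeroSection F E x) = (x, 0) := T.zeroSection ℝ hx
      refine ⟨T.mem_target.2 hx, ?_⟩
      rw [mem_preimage, ← h1]
      have h2 : zeroSection F E x ∈ T.source := (T.mem_source).2 hx
      have h3 := T.toOpenPartialHomeomorph.left_inv h2
      have h4 : T.toOpenPartialHomeomorph.symm (T (zeroSection F E x)) = zeroSection F E x := h3
      rw [h4]
      exact h0 x
    obtain ⟨V, hV, N, hN, hVN⟩ := mem_nhds_prod_iff.1 (hO.mem_nhds hmem)
    obtain ⟨V', hV'V, hV'o, hxV'⟩ := mem_nhds_iff.1 hV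
    obtain ⟨c, hc, hcN⟩ := hBN N hN
    refine ⟨V' ∩ T.baseSet, hV'o.inter T.open_baseSet, ⟨hxV', hx⟩, inter_subset_right, c, hc,
      fun p hp v hv => ?_⟩
    have h1 := hVN (mk_mem_prod (hV'V hp.1) (hcN _ hv))
    have h2 : T.toOpenPartialHomeomorph.symm (p, T.linearMapAt ℝ p v) = ⟨p, v⟩ := by
      have h3 : T ⟨p, v⟩ = (p, T.linearMapAt ℝ p v) := by
        rw [T.coe_linearMapAt_of_mem hp.2]
        exact Prod.ext (T.coe_fst' hp.2) rfl
      rw [← h3]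
      exact T.toOpenPartialHomeomorph.left_inv ((T.mem_source).2 hp.2)
    have h4 := h1.2
    rwa [mem_preimage, h2] at h4
  choose V hVo hxV hVb c hc hcU using hloc
  obtain ⟨ρ, hρ⟩ := SmoothPartitionOfUnity.exists_isSubordinate 𝓘(ℝ, EM) (isClosed_univ (X := M))
    V hVo fun x _ => mem_iUnion_of_mem x (hxV x)
  have hfin : ∀ p, {x | ρ x p ≠ 0}.Finite := fun p => ρ.locallyFinite.point_finite p
  let L : ∀ x p, E p →ₗ[ℝ] F := fun x p => (trivializationAt F E x).linearMapAt ℝ p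
  let b : ∀ _ p, E p →ₗ[ℝ] E p →ₗ[ℝ] ℝ := fun x p =>
    LinearMap.mk₂ ℝ (fun v w => B (L x p v) (L x p w)) (by simp) (by simp) (by simp) (by simp)
  let G : ∀ p, E p →ₗ[ℝ] E p →ₗ[ℝ] ℝ := fun p =>
    -- A weighted average of the local metrics `c x • b x`, whose unit balls already lie in `U`. For
    -- a vector outside `U` every metric contributing at p exceeds 1, and so does their average.
    ∑ x ∈ (hfin p).toFinset, (ρ x p * c x) • b x p
  have hG : ∀ p v w, G p v w =
      ∑ x ∈ (hfin p).toFinset, ρ x p * (c x * B (L x p v) (L x p w)) := fun p v w => by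
    simp [G, b, LinearMap.sum_apply, mul_assoc]
  have hpos : ∀ p, ∀ x ∈ (hfin p).toFinset, 0 < ρ x p ∧ p ∈ V x := fun p x hx => by
    have hx' : ρ x p ≠ 0 := (hfin p).mem_toFinset.1 hx
    exact ⟨lt_of_le_of_ne (ρ.nonneg x p) hx'.symm, hρ x (subset_closure hx')⟩
  have hone : ∀ p, ∑ x ∈ (hfin p).toFinset, ρ x p = 1 := fun p => by
    rw [← ρ.sum_eq_one (mem_univ p)]
    exact (finsum_eq_sum_of_support_subset _ fun x hx => by
      rw [(hfin p).coe_toFinset]; exact hx).symm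
  have hne : ∀ p, (hfin p).toFinset.Nonempty := fun p => by
    rw [Finset.nonempty_iff_ne_empty]
    intro h
    have := hone p
    rw [h, Finset.sum_empty] at this
    exact zero_ne_one this
  refine ⟨G, fun p v w => ?_, fun p v hv => ?_, fun p v hv => ?_, fun ν hν => ?_⟩
  · simp only [hG, hBs (L _ p v)]
  · rw [hG]
    refine Finset.sum_pos (fun x hx => ?_) (hne p)
    obtain ⟨h1, h2⟩ := hpos p x hx
    refine mul_pos h1 (mul_pos (hc x) (hBp _ fun h => hv ?_))
    have h3 := (trivializationAt F E x).symmₗ_linearMapAt (hVb x h2) v (R := ℝ)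
    rw [← h3]
    change (trivializationAt F E x).symmₗ ℝ p (L x p v) = 0
    rw [h, map_zero]
  · by_contra hvU
    have h1 : ∀ x ∈ (hfin p).toFinset, ρ x p < ρ x p * (c x * B (L x p v) (L x p v)) := by
      intro x hx
      obtain ⟨h1, h2⟩ := hpos p x hx
      have h3 : 1 < c x * B (L x p v) (L x p v) := by
        by_contra! h
        exact hvU (hcU x p h2 v h)
      nlinarith
    have h2 := Finset.sum_lt_sum_of_nonempty (hne p) h1
    rw [hone, ← hG] at h2
    exact absurd hv (not_le.2 h2)
  · have heq : (fun e : TotalSpace F E => G e.proj e.2 (ν e)) = fun e =>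
        ∑ᶠ x, ρ x e.proj * (c x * B (L x e.proj e.2) (L x e.proj (ν e))) := by
      funext e
      rw [hG]
      exact (finsum_eq_sum_of_support_subset _ fun x hx => by
        rw [(hfin e.proj).coe_toFinset]; exact fun h => hx (by simp [h])).symm
    rw [heq]
    refine contMDiff_finsum (fun x e₀ => ?_) ?_
    -- The trivialisation is usable only over its base set, which contains this support; away from
    -- the support the summand is locally zero.
    · by_cases hx : e₀.proj ∈ tsupport (ρ x)
      · have hb : e₀.proj ∈ (trivializationAt F E x).baseSet := hVb x (hρ x hx)
        have hL : ∀ {μ : ∀ e : TotalSpace F E, E e.proj},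
            ContMDiff (𝓘(ℝ, EM).prod 𝓘(ℝ, F)) (𝓘(ℝ, EM).prod 𝓘(ℝ, F)) ∞
              (fun e => (⟨e.proj, μ e⟩ : TotalSpace F E)) →
            ContMDiffAt (𝓘(ℝ, EM).prod 𝓘(ℝ, F)) 𝓘(ℝ, F) ∞ (fun e => L x e.proj (μ e)) e₀ := by
          intro μ hμ
          have h1 := (((trivializationAt F E x).contMDiffAt_iff (f := fun e : TotalSpace F E =>
            (⟨e.proj, μ e⟩ : TotalSpace F E)) (x₀ := e₀)
            ((Trivialization.mem_source _).2 hb)).1 (hμ e₀)).2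
          refine h1.congr_of_eventuallyEq ?_
          have hopen : IsOpen ((TotalSpace.proj : TotalSpace F E → M) ⁻¹'
              (trivializationAt F E x).baseSet) :=
            (trivializationAt F E x).open_baseSet.preimage (FiberBundle.continuous_proj F E)
          filter_upwards [hopen.mem_nhds hb] with e he
          exact congrFun ((trivializationAt F E x).coe_linearMapAt_of_mem he) (μ e)
        have hρ' : ContMDiffAt (𝓘(ℝ, EM).prod 𝓘(ℝ, F)) 𝓘(ℝ, ℝ) ∞
            (fun e : TotalSpace F E => ρ x e.proj) e₀ :=
          ((ρ x).contMDiff.comp (contMDiff_proj E)) e₀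
        have hBB : ContMDiffAt (𝓘(ℝ, EM).prod 𝓘(ℝ, F)) 𝓘(ℝ, ℝ) ∞
            (fun e : TotalSpace F E => B (L x e.proj e.2) (L x e.proj (ν e))) e₀ :=
          (B.contDiff.contMDiff.contMDiffAt.comp e₀ (hL contMDiff_id)).clm_apply (hL hν)
        exact hρ'.mul (contMDiffAt_const.mul hBB)
      · have hopen : IsOpen ((TotalSpace.proj : TotalSpace F E → M) ⁻¹' (tsupport (ρ x))ᶜ) :=
          (isClosed_tsupport (ρ x)).isOpen_compl.preimage (FiberBundle.continuous_proj F E)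
        refine (contMDiffAt_const (c := (0 : ℝ))).congr_of_eventuallyEq ?_
        filter_upwards [hopen.mem_nhds hx] with e he
        rw [image_eq_zero_of_notMem_tsupport he, zero_mul]
    · refine (ρ.locallyFinite.preimage_continuous (FiberBundle.continuous_proj F E)).subset ?_
      intro x e he h
      exact he (by simp only; rw [h, zero_mul])

end Metric

/-! ### The cut-off lifts of sections. -/

section Definition

variable {M F : Type*} {E : M → Type*} [∀ p, AddCommGroup (E p)] [∀ p, Module ℝ (E p)]

/-- The section `s`, considered as a field on every fibre and cut off outside the unit ball of the
fibre metric `G`. -/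
def cutoffLift (α β : ℝ → ℝ) (G : ∀ p, E p →ₗ[ℝ] E p →ₗ[ℝ] ℝ) (s : ∀ p, E p)
    (e : TotalSpace F E) : E e.proj :=
  α (G e.proj e.2 e.2) • s e.proj +
    (β (G e.proj e.2 e.2) * G e.proj e.2 (s e.proj)) • e.2

variable {α β : ℝ → ℝ} {G : ∀ p, E p →ₗ[ℝ] E p →ₗ[ℝ] ℝ}

theorem cutoffLift_eq_zero (h1 : ∀ q, 1 ≤ q → α q = 0 ∧ β q = 0) (s : ∀ p, E p)
    {e : TotalSpace F E} (he : 1 ≤ G e.proj e.2 e.2) : cutoffLift α β G s e = 0 := by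
  simp [cutoffLift, h1 _ he]

theorem cutoffLift_eq_self (h1 : ∀ q ≤ 1 / 4, α q = 1 ∧ β q = 0) (s : ∀ p, E p)
    {e : TotalSpace F E} (he : G e.proj e.2 e.2 ≤ 1 / 4) : cutoffLift α β G s e = s e.proj := by
  simp only [cutoffLift, h1 _ he, one_smul, zero_mul, zero_smul, add_zero]

end Definition

section CutoffLift

variable {EM : Type*} [NormedAddCommGroup EM] [NormedSpace ℝ EM]
  {M : Type*} [TopologicalSpace M] [ChartedSpace EM M]
  {F : Type*} [NormedAddCommGroup F] [NormedSpace ℝ F]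
  {E : M → Type*} [TopologicalSpace (TotalSpace F E)]
  [∀ p, AddCommGroup (E p)] [∀ p, Module ℝ (E p)] [∀ p, TopologicalSpace (E p)]
  [FiberBundle F E] [VectorBundle ℝ F E]

theorem contMDiff_totalSpace_smul_add_smul {a b : TotalSpace F E → ℝ}
    {ν μ : ∀ e : TotalSpace F E, E e.proj}
    (ha : ContMDiff (𝓘(ℝ, EM).prod 𝓘(ℝ, F)) 𝓘(ℝ, ℝ) ∞ a)
    (hb : ContMDiff (𝓘(ℝ, EM).prod 𝓘(ℝ, F)) 𝓘(ℝ, ℝ) ∞ b)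
    (hν : ContMDiff (𝓘(ℝ, EM).prod 𝓘(ℝ, F)) (𝓘(ℝ, EM).prod 𝓘(ℝ, F)) ∞
      fun e => (⟨e.proj, ν e⟩ : TotalSpace F E))
    (hμ : ContMDiff (𝓘(ℝ, EM).prod 𝓘(ℝ, F)) (𝓘(ℝ, EM).prod 𝓘(ℝ, F)) ∞
      fun e => (⟨e.proj, μ e⟩ : TotalSpace F E)) :
    ContMDiff (𝓘(ℝ, EM).prod 𝓘(ℝ, F)) (𝓘(ℝ, EM).prod 𝓘(ℝ, F)) ∞
      fun e => (⟨e.proj, a e • ν e + b e • μ e⟩ : TotalSpace F E) := by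
  intro e₀
  have h1 := contMDiffAt_totalSpace.1 (hν e₀)
  have h2 := contMDiffAt_totalSpace.1 (hμ e₀)
  refine contMDiffAt_totalSpace.2 ⟨h1.1, ?_⟩
  refine (((ha e₀).smul h1.2).add ((hb e₀).smul h2.2)).congr_of_eventuallyEq ?_
  have hopen : IsOpen ((TotalSpace.proj : TotalSpace F E → M) ⁻¹'
      (trivializationAt F E e₀.proj).baseSet) :=
    (trivializationAt F E e₀.proj).open_baseSet.preimage (FiberBundle.continuous_proj F E)
  filter_upwards [hopen.mem_nhds (FiberBundle.mem_baseSet_trivializationAt' e₀.proj)] with e he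
  have hL : ∀ v : E e.proj, (trivializationAt F E e₀.proj ⟨e.proj, v⟩).2 =
      (trivializationAt F E e₀.proj).linearMapAt ℝ e.proj v := fun v =>
    (congrFun ((trivializationAt F E e₀.proj).coe_linearMapAt_of_mem he) v).symm
  change (trivializationAt F E e₀.proj ⟨e.proj, a e • ν e + b e • μ e⟩).2 =
    a e • (trivializationAt F E e₀.proj ⟨e.proj, ν e⟩).2 +
      b e • (trivializationAt F E e₀.proj ⟨e.proj, μ e⟩).2
  rw [hL, hL, hL, map_add, map_smul, map_smul]

variable {α β : ℝ → ℝ} {G : ∀ p, E p →ₗ[ℝ] E p →ₗ[ℝ] ℝ}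

theorem contMDiff_cutoffLift (hα : ContDiff ℝ ∞ α) (hβ : ContDiff ℝ ∞ β)
    (hG : ∀ ν : ∀ e : TotalSpace F E, E e.proj,
      ContMDiff (𝓘(ℝ, EM).prod 𝓘(ℝ, F)) (𝓘(ℝ, EM).prod 𝓘(ℝ, F)) ∞
        (fun e => (⟨e.proj, ν e⟩ : TotalSpace F E)) →
      ContMDiff (𝓘(ℝ, EM).prod 𝓘(ℝ, F)) 𝓘(ℝ, ℝ) ∞ fun e => G e.proj e.2 (ν e))
    {s : ∀ p, E p}
    (hs : ContMDiff 𝓘(ℝ, EM) (𝓘(ℝ, EM).prod 𝓘(ℝ, F)) ∞ fun p => TotalSpace.mk' F p (s p)) :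
    ContMDiff (𝓘(ℝ, EM).prod 𝓘(ℝ, F)) (𝓘(ℝ, EM).prod 𝓘(ℝ, F)) ∞
      fun e : TotalSpace F E => (⟨e.proj, cutoffLift α β G s e⟩ : TotalSpace F E) := by
  have hQ := hG (fun e => e.2) contMDiff_id
  have hs' : ContMDiff (𝓘(ℝ, EM).prod 𝓘(ℝ, F)) (𝓘(ℝ, EM).prod 𝓘(ℝ, F)) ∞
      fun e : TotalSpace F E => (⟨e.proj, s e.proj⟩ : TotalSpace F E) :=
    hs.comp (contMDiff_proj E)
  exact contMDiff_totalSpace_smul_add_smul (hα.contMDiff.comp hQ)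
    ((hβ.contMDiff.comp hQ).mul (hG _ hs'))
    hs' contMDiff_id

theorem map_vertLift_wedge {ι : Type*} [Fintype ι] (e : TotalSpace F E) (v w : ι → E e.proj) :
    ∑ i, wedge (vertLift 𝓘(ℝ, EM) e (v i)) (vertLift 𝓘(ℝ, EM) e (w i)) =
      exteriorPower.map 2 (vertLift 𝓘(ℝ, EM) e) (∑ i, wedge (v i) (w i)) := by
  simp only [map_sum, map_wedge]

theorem vsupp_vertLift_cutoffLift_subset (h1 : ∀ q, 1 ≤ q → α q = 0 ∧ β q = 0)
    (hG : Continuous fun e : TotalSpace F E => G e.proj e.2 e.2) (s : ∀ p, E p) :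
    vsupp (𝓘(ℝ, EM).prod 𝓘(ℝ, F))
      (fun e : TotalSpace F E => vertLift 𝓘(ℝ, EM) e (cutoffLift α β G s e)) ⊆
      {e | G e.proj e.2 e.2 ≤ 1} := by
  refine closure_minimal (fun e he => ?_) (isClosed_le hG continuous_const)
  by_contra h
  refine he ?_
  change vertLift 𝓘(ℝ, EM) e (cutoffLift α β G s e) = 0
  rw [cutoffLift_eq_zero h1 s (not_le.1 h).le, map_zero]

variable [FiniteDimensional ℝ F]

/-- The form on the model fibre induced by a form on the fibre at `p`. -/
noncomputable def modelForm (G : ∀ p, E p →ₗ[ℝ] E p →ₗ[ℝ] ℝ) (p : M) : F →L[ℝ] F →L[ℝ] ℝ :=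
  LinearMap.toContinuousBilinearMap ((G p).compl₁₂
    (fiberEquiv F E p).symm.toLinearEquiv.toLinearMap
    (fiberEquiv F E p).symm.toLinearEquiv.toLinearMap)

theorem modelForm_apply (p : M) (y z : F) : modelForm G p y z =
    G p ((fiberEquiv F E p).symm y) ((fiberEquiv F E p).symm z) := rfl

theorem modelForm_pos (hG : ∀ p v, v ≠ 0 → 0 < G p v v) (p : M) (y : F) (hy : y ≠ 0) :
    0 < modelForm G p y y :=
  hG p _ fun h => hy ((map_eq_zero_iff _ (fiberEquiv F E p).symm.injective).1 h)

/-- The bridge to the computations on a single vector space: commutation and compact support are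
transferred through it. -/
theorem fiberField_cutoffLift (s : ∀ p, E p) (p : M) :
    fiberField (cutoffLift α β G s) p =
      cutoffField α β (modelForm G p) (fiberEquiv F E p (s p)) := by
  funext y
  change fiberEquiv F E p (α _ • s p + (β _ * G p _ (s p)) • (fiberEquiv F E p).symm y) = _
  rw [map_add, map_smul, map_smul, ContinuousLinearEquiv.apply_symm_apply, cutoffField,
    modelForm_apply, modelForm_apply, ContinuousLinearEquiv.symm_apply_apply]
  rfl

theorem hasCompactSupport_fiberField_cutoffLift (h1 : ∀ q, 1 ≤ q → α q = 0 ∧ β q = 0)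
    (hG : ∀ p v, v ≠ 0 → 0 < G p v v) (s : ∀ p, E p) (p : M) :
    HasCompactSupport (fiberField (cutoffLift α β G s : ∀ e : TotalSpace F E, E e.proj) p) := by
  refine HasCompactSupport.intro (isCompact_setOf_form_le_one _ (modelForm_pos hG p)) fun y hy => ?_
  have h := h1 _ (not_le.1 hy).le
  rw [fiberField_cutoffLift]
  simp [cutoffField, h]

theorem fderiv_fiberField_cutoffLift_comm (hα : ContDiff ℝ ∞ α) (hβ : ContDiff ℝ ∞ β)
    (h : ∀ q, 2 * deriv α q * (α q + β q * q) = α q * β q)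
    (hG : ∀ p v w, G p v w = G p w v) (s t : ∀ p, E p) (p : M) (y : F) :
    fderiv ℝ (fiberField (cutoffLift α β G t) p) y (fiberField (cutoffLift α β G s) p y) =
      fderiv ℝ (fiberField (cutoffLift α β G s) p) y (fiberField (cutoffLift α β G t) p y) := by
  rw [fiberField_cutoffLift, fiberField_cutoffLift]
  exact fderiv_cutoffField_comm (hα.differentiable (by simp)) (hβ.differentiable (by simp)) h _
    (fun y z => hG p _ _) _ _ y

theorem isCompact_vsupp_vertLift_cutoffLift_inter (h1 : ∀ q, 1 ≤ q → α q = 0 ∧ β q = 0)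
    (hG : Continuous fun e : TotalSpace F E => G e.proj e.2 e.2)
    (hpos : ∀ p v, v ≠ 0 → 0 < G p v v) (s : ∀ p, E p) (p : M) :
    IsCompact (vsupp (𝓘(ℝ, EM).prod 𝓘(ℝ, F))
      (fun e : TotalSpace F E => vertLift 𝓘(ℝ, EM) e (cutoffLift α β G s e)) ∩
      TotalSpace.proj ⁻¹' {p}) := by
  have hc := (isCompact_setOf_form_le_one _ (modelForm_pos (F := F) hpos p)).image
    (contMDiff_fiberIncl (EM := EM) (F := F) (E := E) p).continuous
  have heq : vsupp (𝓘(ℝ, EM).prod 𝓘(ℝ, F))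
      (fun e : TotalSpace F E => vertLift 𝓘(ℝ, EM) e (cutoffLift α β G s e)) ∩
      TotalSpace.proj ⁻¹' {p} = vsupp (𝓘(ℝ, EM).prod 𝓘(ℝ, F))
      (fun e : TotalSpace F E => vertLift 𝓘(ℝ, EM) e (cutoffLift α β G s e)) ∩
      fiberIncl F E p '' {y | modelForm G p y y ≤ 1} := by
    ext e
    refine and_congr_right fun he => ⟨?_, ?_⟩
    · rintro rfl
      refine ⟨fiberEquiv F E e.proj e.2, ?_, fiberIncl_fiberEquiv e⟩
      have := vsupp_vertLift_cutoffLift_subset h1 hG s he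
      simpa [modelForm_apply] using this
    · rintro ⟨y, -, rfl⟩
      rfl
  rw [heq]
  exact hc.inter_left isClosed_closure

end CutoffLift

end VerticalPoisson

theorem mainTheorem4
    {EM : Type*} [NormedAddCommGroup EM] [NormedSpace ℝ EM] [FiniteDimensional ℝ EM]
    {M : Type*} [TopologicalSpace M] [ChartedSpace EM M] [IsManifold 𝓘(ℝ, EM) ∞ M]
    [T2Space M] [SecondCountableTopology M]
    {F : Type*} [NormedAddCommGroup F] [NormedSpace ℝ F] [FiniteDimensional ℝ F]
    (E : M → Type*) [TopologicalSpace (TotalSpace F E)]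
    [∀ p, AddCommGroup (E p)] [∀ p, Module ℝ (E p)] [∀ p, TopologicalSpace (E p)]
    [FiberBundle F E] [VectorBundle ℝ F E] [ContMDiffVectorBundle ∞ F E 𝓘(ℝ, EM)] :
    ∃ d₀ : ℕ, ∀ d : ℕ, d₀ ≤ d →
      ∀ (γ : ∀ p, ⋀[ℝ]^2 (E p))
        (_ : VerticalPoisson.IsSmoothBivectorSection 𝓘(ℝ, EM) F E γ)
        (U : Set (TotalSpace F E)) (_ : IsOpen U) (_ : ∀ p, zeroSection F E p ∈ U),
      ∃ (X Y : Fin d → ∀ e : TotalSpace F E, TangentSpace (𝓘(ℝ, EM).prod 𝓘(ℝ, F)) e)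
        (U' : Set (TotalSpace F E)),
        (IsOpen U' ∧ U' ⊆ U ∧ ∀ p, zeroSection F E p ∈ U') ∧
        (∀ i, VerticalPoisson.IsSmoothVectorField (𝓘(ℝ, EM).prod 𝓘(ℝ, F)) (X i) ∧
          VerticalPoisson.IsSmoothVectorField (𝓘(ℝ, EM).prod 𝓘(ℝ, F)) (Y i)) ∧
        (∀ i e, X i e ∈ VerticalPoisson.vertSpace 𝓘(ℝ, EM) e ∧
          Y i e ∈ VerticalPoisson.vertSpace 𝓘(ℝ, EM) e) ∧
        (∀ i, VerticalPoisson.vsupp (𝓘(ℝ, EM).prod 𝓘(ℝ, F)) (X i) ⊆ U ∧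
          VerticalPoisson.vsupp (𝓘(ℝ, EM).prod 𝓘(ℝ, F)) (Y i) ⊆ U) ∧
        (∀ i p,
          IsCompact (VerticalPoisson.vsupp (𝓘(ℝ, EM).prod 𝓘(ℝ, F)) (X i) ∩
            TotalSpace.proj ⁻¹' {p}) ∧
          IsCompact (VerticalPoisson.vsupp (𝓘(ℝ, EM).prod 𝓘(ℝ, F)) (Y i) ∩
            TotalSpace.proj ⁻¹' {p})) ∧
        (∀ i j, VerticalPoisson.Commute (𝓘(ℝ, EM).prod 𝓘(ℝ, F)) (X i) (X j) ∧
          VerticalPoisson.Commute (𝓘(ℝ, EM).prod 𝓘(ℝ, F)) (X i) (Y j) ∧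
          VerticalPoisson.Commute (𝓘(ℝ, EM).prod 𝓘(ℝ, F)) (Y i) (Y j)) ∧
        (∀ i, VerticalPoisson.IsCompleteVectorField (𝓘(ℝ, EM).prod 𝓘(ℝ, F)) (X i) ∧
          VerticalPoisson.IsCompleteVectorField (𝓘(ℝ, EM).prod 𝓘(ℝ, F)) (Y i)) ∧
        VerticalPoisson.IsPoissonStructure (𝓘(ℝ, EM).prod 𝓘(ℝ, F))
          (fun e : TotalSpace F E => ∑ i, VerticalPoisson.wedge (X i e) (Y i e)) ∧
        (∀ e, VerticalPoisson.IsVerticalBivector 𝓘(ℝ, EM) e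
          (∑ i, VerticalPoisson.wedge (X i e) (Y i e))) ∧
        ∀ e ∈ U', ∑ i, VerticalPoisson.wedge (X i e) (Y i e) =
          VerticalPoisson.vertLiftBivector 𝓘(ℝ, EM) γ e := by
  -- General position needs d strictly larger than dim M + rank E.
  refine ⟨Module.finrank ℝ EM + Module.finrank ℝ F + 1, fun d hd γ hγ U hU h0 => ?_⟩
  obtain ⟨S, hS, hspan⟩ := VerticalPoisson.exists_generating_sections EM F E
    (Nat.lt_of_succ_le hd)
  obtain ⟨T, hT, hST⟩ := VerticalPoisson.exists_wedge_decomposition hS hspan hγ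
  obtain ⟨G, hsymm, hpos, hGU, hG⟩ := VerticalPoisson.exists_fiber_metric (EM := EM) hU h0
  obtain ⟨α, β, hα, hβ, hin, hout, hode⟩ := VerticalPoisson.exists_cutoff
  have hQ : Continuous fun e : TotalSpace F E => G e.proj e.2 e.2 :=
    (hG (fun e => e.2) contMDiff_id).continuous
  have hν := fun i => VerticalPoisson.contMDiff_cutoffLift hα hβ hG (hS i)
  have hμ := fun i => VerticalPoisson.contMDiff_cutoffLift hα hβ hG (hT i)
  have hcomm := VerticalPoisson.fderiv_fiberField_cutoffLift_comm (F := F) hα hβ hode hsymm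
  have hsub : ∀ s : ∀ p, E p, VerticalPoisson.vsupp (𝓘(ℝ, EM).prod 𝓘(ℝ, F))
      (fun e : TotalSpace F E => VerticalPoisson.vertLift 𝓘(ℝ, EM) e
        (VerticalPoisson.cutoffLift α β G s e)) ⊆ U := fun s e he =>
    hGU e.proj e.2 (VerticalPoisson.vsupp_vertLift_cutoffLift_subset hout hQ s he)
  have hcpt := VerticalPoisson.isCompact_vsupp_vertLift_cutoffLift_inter (EM := EM) hout hQ hpos
  have hcs := VerticalPoisson.hasCompactSupport_fiberField_cutoffLift (F := F) hout hpos
  refine ⟨fun i e => VerticalPoisson.vertLift 𝓘(ℝ, EM) e (VerticalPoisson.cutoffLift α β G (S i) e),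
    fun i e => VerticalPoisson.vertLift 𝓘(ℝ, EM) e (VerticalPoisson.cutoffLift α β G (T i) e),
    -- Here α = 1 and β = 0, so the cut-off fields are the plain vertical lifts of Sᵢ and Tᵢ.
    {e | G e.proj e.2 e.2 < 1 / 4},
    ⟨isOpen_lt hQ continuous_const, fun e he => hGU e.proj e.2 (he.le.trans (by norm_num)),
      fun p => ?_⟩,
    fun i => ⟨VerticalPoisson.isSmoothVectorField_vertLift (hν i),
      VerticalPoisson.isSmoothVectorField_vertLift (hμ i)⟩,
    fun i e => ⟨VerticalPoisson.vertLift_mem_vertSpace e _,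
      VerticalPoisson.vertLift_mem_vertSpace e _⟩,
    fun i => ⟨hsub _, hsub _⟩, fun i p => ⟨hcpt _ p, hcpt _ p⟩,
    fun i j => ⟨VerticalPoisson.mlieBracket_vertLift_eq_zero (hν i) (hν j) (hcomm _ _),
      VerticalPoisson.mlieBracket_vertLift_eq_zero (hν i) (hμ j) (hcomm _ _),
      VerticalPoisson.mlieBracket_vertLift_eq_zero (hμ i) (hμ j) (hcomm _ _)⟩,
    fun i => ⟨VerticalPoisson.isCompleteVectorField_vertLift (hν i) (hcs _),
      VerticalPoisson.isCompleteVectorField_vertLift (hμ i) (hcs _)⟩,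
    VerticalPoisson.isPoissonStructure_sum_wedge_vertLift hν hμ (fun i j => hcomm _ _)
      (fun i j => hcomm _ _) (fun i j => hcomm _ _),
    fun e => VerticalPoisson.sum_wedge_mem_range _
      (fun i => VerticalPoisson.vertLift_mem_vertSpace e _)
      (fun i => VerticalPoisson.vertLift_mem_vertSpace e _), fun e he => ?_⟩
  · change G p 0 0 < 1 / 4
    rw [map_zero]
    norm_num
  · have hs : ∀ s : ∀ p, E p, VerticalPoisson.cutoffLift α β G s e = s e.proj := fun s =>
      VerticalPoisson.cutoffLift_eq_self hin s he.le
    simp only [hs]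
    rw [VerticalPoisson.map_vertLift_wedge, hST, VerticalPoisson.vertLiftBivector]
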